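/- Let $\mathbb K$ be a field of characteristic zero. Let $\mathcal{OF}$ be the vector space spanned by ordered forests of planar rooted trees, with concatenation as product, the empty forest $\emptyset$, the shuffle product $\sqcup\!\sqcup$ (forests being words in trees), and the left grafting product $\triangleright$: for trees $\tau,\tau_1$ and forests $\omega,\omega_1$, $\tau\triangleright\omega$ is the sum of all forests obtained by adding an edge from some vertex of $\omega$ to the root of $\tau$, leftmost on that vertex, $\emptyset\triangleright\omega=\omega$ and $(\tau_1\omega_1)\triangleright\omega=\tau_1\triangleright(\omega_1\triangleright\omega)-(\tau_1\triangleright\omega_1)\triangleright\omega$. Let $\bullet$ be the single-vertex tree, $B^+(\omega)=\omega\triangleright\bullet$, let $B^-$ be removal of the root, and let $\omega_1\diamond\omega_2=B^-(\omega_1\triangleright B^+(\omega_2))$ be the planar Grossman--Larson product. Let $\langle\cdot,\cdot\rangle$ be the pairing for which the forests are orthonormal. The coproduct $\Delta_N(\omega)=\sum_{\omega_1,\omega_2}\langle\omega_1\diamond\omega_2,\omega\rangle\,\omega_1\otimes\omega_2$ (sum over forests) defines the convolution $\beta\star_N\gamma=(\beta\otimes\gamma)\Delta_N$ on $\mathcal{OF}^*$.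 A linear map $\beta\in\mathcal{OF}^*$ is exponential if $\beta(\emptyset)=1$ and $\beta(x\sqcup\!\sqcup y)=\beta(x)\beta(y)$ for all $x,y$. Let $Lie(\mathcal{PT})\subset\mathcal{OF}$ be the Lie subalgebra (for the commutator) generated by the planar trees, and fix a basis of it consisting of elements that are homogeneous for the number of vertices; it identifies $Lie(\mathcal{PT})$ with its graded dual. For a forest $\omega'$ with vertices labelled $1,\dots,n$ and $\omega_1,\dots,\omega_n\in Lie(\mathcal{PT})$, let $\omega_1\cdots\omega_n\circ\omega'\in\mathcal{OF}$ be obtained by writing $\omega'$ in terms of its vertices, concatenation and $\triangleright$, and replacing vertex $i$ by $\omega_i$. Let $$\rho:\mathcal{OF}\to S(Lie(\mathcal{PT}))\otimes\mathcal{OF},\qquad \rho(\omega)=\sum\frac1{n!}\,\langle\omega_1\cdots\omega_n\circ\omega',\omega\rangle\;\omega_1\cdots\omega_n\otimes\omega',$$ the sum running over all $n\ge 0$, all labelled forests $\omega'$ with $n$ vertices and all basis elements $\omega_1,\dots,\omega_n$. For $\hat\alpha\in Lie(\mathcal{PT})^*$, extended to a character of the symmetric algebra $S(Lie(\mathcal{PT}))$,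 and $\beta\in\mathcal{OF}^*$, put $\hat\alpha\star\beta=(\hat\alpha\otimes\beta)\rho$. Then the exponential linear maps form a group under $\star_N$, and for every $\hat\alpha\in Lie(\mathcal{PT})^*$ the map $\beta\mapsto\hat\alpha\star\beta$ restricts to a group endomorphism of it. This endomorphism is an automorphism if and only if $\hat\alpha(\bullet)\neq0$. -/

import Mathlib

open scoped TensorProduct

/- The commutator bracket of an associative algebra. -/
attribute [local instance] LieRing.ofAssociativeRing

namespace LieButcher

/-! ### Planar rooted trees and ordered forests -/

/-- A planar rooted tree: a root together with the ordered list (left to right) of the subtrees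
attached to it. -/
inductive PTree : Type
  | node : List PTree → PTree

/-- An ordered forest is a finite sequence of planar rooted trees; `[]` is the empty forest. -/
abbrev Forest : Type := List PTree

/-- The single-vertex tree. -/
def PTree.leaf : PTree := PTree.node []

mutual

/-- The number of vertices of a planar tree. -/
def PTree.vertices : PTree → ℕ
  | .node ts => Forest.vertices ts + 1

/-- The number of vertices of an ordered forest. -/
def Forest.vertices : List PTree → ℕ
  | [] => 0
  | t :: ts => PTree.vertices t + Forest.vertices ts

end

/-- There are finitely many ordered forests with a given number of vertices. -/
theorem Forest.finite_vertices_le (n : ℕ) : {ω : Forest | Forest.vertices ω ≤ n}.Finite := by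
  induction n with
  | zero =>
    refine (Set.finite_singleton ([] : Forest)).subset ?_
    rintro (_ | ⟨⟨ts⟩, rest⟩) h
    · rfl
    · simp [Forest.vertices, PTree.vertices] at h
  | succ n ih =>
    refine ((Set.finite_singleton ([] : Forest)).union
      ((ih.prod ih).image fun p : Forest × Forest => PTree.node p.1 :: p.2)).subset ?_
    rintro (_ | ⟨⟨ts⟩, rest⟩) h
    · exact Or.inl rfl
    · refine Or.inr ⟨(ts, rest), ⟨?_, ?_⟩, rfl⟩ <;>
      · simp only [Forest.vertices, PTree.vertices, Set.mem_ofPred_eq] at h ⊢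
        omega

/-- The ordered forests with exactly `n` vertices. -/
def ForestOfSize (n : ℕ) : Type := {ω : Forest // Forest.vertices ω = n}

noncomputable instance (n : ℕ) : Fintype (ForestOfSize n) :=
  ((Forest.finite_vertices_le n).subset fun _ h => le_of_eq h).fintype

/-- All shuffles of two ordered forests, with multiplicity. -/
def shuffles : Forest → Forest → List Forest
  | [], ω₂ => [ω₂]
  | τ₁ :: ω₁, [] => [τ₁ :: ω₁]
  | τ₁ :: ω₁, τ₂ :: ω₂ =>
      (shuffles ω₁ (τ₂ :: ω₂)).map (fun ω => τ₁ :: ω) ++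
        (shuffles (τ₁ :: ω₁) ω₂).map (fun ω => τ₂ :: ω)
  termination_by ω₁ ω₂ => ω₁.length + ω₂.length

mutual

/-- All ways of adding an edge from some vertex of a tree to the root of `τ`, leftmost on that
vertex. -/
def PTree.graftings (τ : PTree) : PTree → List PTree
  | .node ts => .node (τ :: ts) :: (Forest.graftings τ ts).map PTree.node

/-- All ways of adding an edge from some vertex of a forest to the root of `τ`, leftmost on that
vertex. -/
def Forest.graftings (τ : PTree) : List PTree → List (List PTree)
  | [] => []
  | t :: ts =>
      (PTree.graftings τ t).map (fun t' => t' :: ts) ++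
        (Forest.graftings τ ts).map (fun ts' => t :: ts')

end

theorem Forest.length_of_mem_graftings (τ : PTree) :
    ∀ (ω ω' : Forest), ω' ∈ Forest.graftings τ ω → ω'.length = ω.length
  | [], _, h => by simp [Forest.graftings] at h
  | t :: ts, ω', h => by
    simp only [Forest.graftings, List.mem_append, List.mem_map] at h
    rcases h with ⟨t', _, rfl⟩ | ⟨ts', h', rfl⟩
    · simp
    · simpa using Forest.length_of_mem_graftings τ ts ts' h'

noncomputable section

/-! ### The space of ordered forests -/

section Space

variable (K : Type*) [Field K]

/-- The vector space spanned by the ordered forests, with concatenation as product. -/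
abbrev OF : Type _ := MonoidAlgebra K (FreeMonoid PTree)

/-- The basis vector of a forest. -/
def basisForest (ω : Forest) : OF K := MonoidAlgebra.single (FreeMonoid.ofList ω) 1

/-- The single-vertex tree as an element of the space of ordered forests. -/
def bullet : OF K := basisForest K [PTree.leaf]

variable {K}

/-- The pairing `⟨x, ω⟩`: the coefficient of the forest `ω` in `x`. -/
def coeffAt (ω : Forest) (x : OF K) : K := x.coeff (FreeMonoid.ofList ω)

/-- The linear extension of a map defined on forests. -/
def linExt {M : Type*} [AddCommGroup M] [Module K M] (f : Forest → M) : OF K →ₗ[K] M :=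
  (MonoidAlgebra.basis (FreeMonoid PTree) K).constr K fun w => f (FreeMonoid.toList w)

/-- The shuffle product. -/
def shuffle : OF K →ₗ[K] OF K →ₗ[K] OF K :=
  linExt fun ω₁ => linExt fun ω₂ => ((shuffles ω₁ ω₂).map (basisForest K)).sum

/-- Left grafting `τ ▷ x` of a planar tree. -/
def graftTree (τ : PTree) : OF K →ₗ[K] OF K :=
  linExt fun ω => ((Forest.graftings τ ω).map (basisForest K)).sum

/-- Left grafting of a forest, by `∅ ▷ x = x` and
`(τ ω) ▷ x = τ ▷ (ω ▷ x) - (τ ▷ ω) ▷ x`. -/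
def graftForest : Forest → (OF K →ₗ[K] OF K)
  | [] => LinearMap.id
  | τ :: ω =>
      graftTree τ ∘ₗ graftForest ω -
        ((Forest.graftings τ ω).attach.map fun ω' => graftForest ω'.1).sum
  termination_by ω => ω.length
  decreasing_by
    · simp
    · have := Forest.length_of_mem_graftings τ ω ω'.1 ω'.2
      simp [this]

/-- Left grafting `x ▷ y` on the space of ordered forests. -/
def graft : OF K →ₗ[K] OF K →ₗ[K] OF K := linExt graftForest

/-- `B⁺(x) = x ▷ •`. -/
def Bplus : OF K →ₗ[K] OF K := graft.flip (bullet K)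

/-- `B⁻` removes the root of a tree. (Forests that are not a single tree are sent to `0`; only the
values on trees matter.) -/
def Bminus : OF K →ₗ[K] OF K :=
  linExt fun
    | [.node ts] => basisForest K ts
    | _ => 0

/-- The planar Grossman--Larson product `x ⋄ y = B⁻(x ▷ B⁺(y))`. -/
def grossmanLarson (x y : OF K) : OF K := Bminus (graft x (Bplus y))

/-- The coproduct `Δ_N` of the Munthe-Kaas--Wright Hopf algebra, the dual of the planar
Grossman--Larson product. As `ω₁ ⋄ ω₂` is homogeneous of degree `|ω₁| + |ω₂|`, the sum over all pairs
of forests with `⟨ω₁ ⋄ ω₂, ω⟩ ≠ 0` is a sum over pairs with `|ω₁| + |ω₂| = |ω|`. -/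
def deltaN : OF K →ₗ[K] OF K ⊗[K] OF K :=
  linExt fun ω =>
    ∑ p ∈ Finset.HasAntidiagonal.antidiagonal (Forest.vertices ω),
      ∑ ω₁ : ForestOfSize p.1, ∑ ω₂ : ForestOfSize p.2,
        coeffAt ω (grossmanLarson (basisForest K ω₁.1) (basisForest K ω₂.1)) •
          (basisForest K ω₁.1 ⊗ₜ[K] basisForest K ω₂.1)

/-- The convolution product `β ⋆_N γ = (β ⊗ γ) Δ_N` on the linear dual. -/
def convN (β γ : Module.Dual K (OF K)) : Module.Dual K (OF K) :=
  LinearMap.mul' K K ∘ₗ TensorProduct.map β γ ∘ₗ deltaN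

/-- Exponential linear maps. -/
def IsExponential (β : Module.Dual K (OF K)) : Prop :=
  β (basisForest K []) = 1 ∧ ∀ x y : OF K, β (shuffle x y) = β x * β y

variable (K)

/-- The exponential linear maps. -/
abbrev ExpMap : Type _ := {β : Module.Dual K (OF K) // IsExponential β}

/-! ### Lie polynomials -/

/-- The Lie polynomials: the Lie subalgebra, for the commutator bracket, generated by the planar
trees. -/
def LiePT : LieSubalgebra K (OF K) :=
  LieSubalgebra.lieSpan K (OF K) (Set.range fun τ : PTree => basisForest K [τ])

/-- The single-vertex tree as a Lie polynomial. -/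
def lieBullet : LiePT K :=
  ⟨bullet K, LieSubalgebra.subset_lieSpan ⟨PTree.leaf, rfl⟩⟩

/-- The span of the forests with exactly `d` vertices. -/
def homogeneous (d : ℕ) : Submodule K (OF K) :=
  Submodule.span K {x | ∃ ω : Forest, Forest.vertices ω = d ∧ x = basisForest K ω}

/-- The Lie polynomials that are homogeneous with `d` vertices. -/
def LiePTDeg (d : ℕ) : Submodule K (LiePT K) :=
  (homogeneous K d).comap ((LiePT K).incl : LiePT K →ₗ[K] OF K)

end Space

/-! ### Substituting Lie polynomials into the vertices of a forest -/

section Substitution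

variable {K : Type*} [Field K]

mutual

/-- `treeSubst f k τ`: the vertices of `τ` are numbered `k, k + 1, …` in preorder (root first, then the
subtrees from left to right) and vertex number `i` is replaced by `f i`, in the expression
`τ = B⁻(τ) ▷ •`. -/
def treeSubst (f : ℕ → OF K) (k : ℕ) : PTree → OF K
  | .node ts => graft (forestSubst f (k + 1) ts) (f k)

/-- The same for a forest, which is the concatenation product of its trees. -/
def forestSubst (f : ℕ → OF K) (k : ℕ) : List PTree → OF K
  | [] => 1
  | t :: ts => treeSubst f k t * forestSubst f (k + PTree.vertices t) ts

end

/-- A forest `ω'` with `n` vertices is labelled by a permutation `σ`: its `i`-th vertex in preorder gets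
the label `σ i`. `compose x ω' σ` is `x₁ ⋯ x_n ∘ ω'`: the vertex labelled `j` is replaced by the
Lie polynomial `x j`. -/
def compose {n : ℕ} (x : Fin n → LiePT K) (ω' : Forest) (σ : Equiv.Perm (Fin n)) : OF K :=
  forestSubst (fun i => if h : i < n then (x (σ ⟨i, h⟩) : OF K) else 0) 0 ω'

variable {κ : ℕ → Type*} [∀ d, Fintype (κ d)]

/-- The coaction `ρ(ω) = ∑ (1 / n!) ⟨ω₁ ⋯ ω_n ∘ ω', ω⟩ ω₁ ⋯ ω_n ⊗ ω'`, with values in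
`S(Lie(PT)) ⊗ OF`. It is the dual of the substitution, where the space of Lie polynomials is identified
with its graded dual through a homogeneous basis `b`. The sum runs over the labelled forests `ω'` with
`n` vertices and over the basis elements `ω₁, …, ω_n`. As `ω₁ ⋯ ω_n ∘ ω'` is homogeneous of degree
`|ω₁| + ⋯ + |ω_n|` and all `|ω_i| ≥ 1`, only `n ≤ |ω|` and `|ω_i| ≤ |ω|` contribute. -/
def coaction (b : ∀ d, Module.Basis (κ d) K (LiePTDeg K d)) :
    OF K →ₗ[K] SymmetricAlgebra K (LiePT K) ⊗[K] OF K :=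
  linExt fun ω =>
    ∑ n ∈ Finset.range (Forest.vertices ω + 1),
      ∑ ω' : ForestOfSize n, ∑ σ : Equiv.Perm (Fin n),
        ∑ c : Fin n → (Σ d : Fin (Forest.vertices ω + 1), κ d),
          ((n.factorial : K)⁻¹ *
              coeffAt ω (compose (fun i => (b (c i).1 (c i).2 : LiePT K)) ω'.1 σ)) •
            ((∏ i, SymmetricAlgebra.ι K (LiePT K) (b (c i).1 (c i).2 : LiePT K)) ⊗ₜ[K]
              basisForest K ω'.1)

/-- `x ⋆ y = (x ⊗ y) ρ`. -/
def star (b : ∀ d, Module.Basis (κ d) K (LiePTDeg K d))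
    (x : Module.Dual K (SymmetricAlgebra K (LiePT K))) (y : Module.Dual K (OF K)) :
    Module.Dual K (OF K) :=
  LinearMap.mul' K K ∘ₗ TensorProduct.map x y ∘ₗ coaction b

/-- The extension of a linear form on Lie polynomials to a character of `S(Lie(PT))`. -/
def character (α : Module.Dual K (LiePT K)) : Module.Dual K (SymmetricAlgebra K (LiePT K)) :=
  (SymmetricAlgebra.lift α : SymmetricAlgebra K (LiePT K) →ₐ[K] K).toLinearMap

end Substitution

end

end LieButcher

/-!
A linear form `β` on ordered forests is the same thing as a formal series `∑ β(ω) ω` of forests,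
and everything in the statement is the extension to series of an operation on `OF`.

* The convolution `⋆_N` is the Grossman--Larson product `⋄` of series (`IsTruncation.convN`).
* Exponential linear maps are the series that are group-like for the unshuffle coproduct `Δ`,
  since `Δ` is dual to the shuffle product (`coeffTensor_unshuffle`).
* By polarisation, `α̂ ⋆ β` is the image of the series `β` under the substitution `• ↦ a`, where
  `a = ∑ α(e) e` is summed over the homogeneous basis of Lie polynomials (`sum_compose`,
  `IsTruncation.star`).

The statement thus reduces to three facts on `OF`: `⋄` is associative, `Δ` is multiplicative for
`⋄`, and the substitution of a Lie polynomial `L` is a morphism for both `⋄` and `Δ`. They come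
from one principle. Call a linear map `ρ : OF → End V` with `ρ(1) = 1` and `ρ(τ x) = ρ(τ) ρ(x) -
ρ(τ ▷ x)` for every tree `τ` a grafting representation (`IsGraftingRep`). Left grafting and left
multiplication for `⋄` are such representations, so are tensor products of them formed with `Δ`
(`IsGraftingRep.tensorRep`), and a linear map that intertwines two of them on trees intertwines
them everywhere (`IsGraftingRep.intertwine`). The three facts are intertwining properties, to be
checked on trees only, where `τ ⋄ x = τ x + τ ▷ x` and `τ ▷ ·` is a derivation. For the
substitution one also needs that these two properties of `τ` hold for every Lie polynomial: they
hold for all primitive elements (`IsPrimitive.graft_mul`, `IsPrimitive.glMul`), and `OF ▷ Lie(PT)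
⊆ Lie(PT)`.

Series are handled by their truncations, which are elements of `OF`, modulo the subspaces
`filtration K n` spanned by the forests with at least `n` vertices. With respect to this
filtration, left multiplication by a group-like series is unipotent, and the substitution of `a =
c • + ⋯` is triangular with diagonal entries `c ^ n`. If `c ≠ 0` such operators are invertible
(`bijective_of_isTriangular`) and so are their tensor squares, whence preimages of group-like
series are group-like (`isExponential_of_triangular`). This gives the inverses in the group and
the bijectivity of `β ↦ α̂ ⋆ β`. Here `c` is `α(•)` up to a non-zero square
(`exists_coeffAt_leaf_lieSeries`). If `c = 0`, the image consists of forms that vanish on `•`,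
while some exponential maps do not (`expLength`).
-/

namespace LieButcher

noncomputable section

variable {K : Type*} [Field K]

/-! ### The forest basis -/

section Basis

variable {M : Type*} [AddCommGroup M] [Module K M]

@[simp]
theorem linExt_basisForest (f : Forest → M) (ω : Forest) : linExt f (basisForest K ω) = f ω := by
  have := (MonoidAlgebra.basis (FreeMonoid PTree) K).constr_basis K
    (fun w => f (FreeMonoid.toList w)) (FreeMonoid.ofList ω)
  simpa [linExt, basisForest] using this

theorem linearMap_ext {f g : OF K →ₗ[K] M}
    (h : ∀ ω, f (basisForest K ω) = g (basisForest K ω)) : f = g :=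
  (MonoidAlgebra.basis (FreeMonoid PTree) K).ext fun w => h (FreeMonoid.toList w)

theorem basisForest_nil : basisForest K [] = 1 := rfl

theorem basisForest_append (ω₁ ω₂ : Forest) :
    basisForest K (ω₁ ++ ω₂) = basisForest K ω₁ * basisForest K ω₂ := by
  simp [basisForest, MonoidAlgebra.single_mul_single]

theorem basisForest_cons (τ : PTree) (ω : Forest) :
    basisForest K (τ :: ω) = basisForest K [τ] * basisForest K ω :=
  basisForest_append [τ] ω

end Basis

/-! ### Left grafting -/

theorem graftTree_basisForest (τ : PTree) (ω : Forest) :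
    graftTree τ (basisForest K ω) = ((Forest.graftings τ ω).map (basisForest K)).sum := by
  simp [graftTree]

theorem graftTree_cons (τ t : PTree) (ts : Forest) :
    graftTree τ (basisForest K (t :: ts)) =
      graftTree τ (basisForest K [t]) * basisForest K ts +
        basisForest K [t] * graftTree τ (basisForest K ts) := by
  have h1 : (fun t' => basisForest K (t' :: ts)) =
      fun t' => basisForest K [t'] * basisForest K ts := funext fun t' => basisForest_cons t' ts
  have h2 : (fun ts' => basisForest K (t :: ts')) =
      fun ts' => basisForest K [t] * basisForest K ts' := funext fun t' => basisForest_cons t t'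
  simp [graftTree_basisForest, Forest.graftings, Function.comp_def, h1, h2,
    List.sum_map_mul_left, List.sum_map_mul_right]

theorem graftTree_one (τ : PTree) : graftTree τ (1 : OF K) = 0 := by
  rw [← basisForest_nil, graftTree_basisForest]; simp [Forest.graftings]

theorem graftTree_mul (τ : PTree) (x y : OF K) :
    graftTree τ (x * y) = graftTree τ x * y + x * graftTree τ y := by
  suffices h : (LinearMap.mul K (OF K)).compr₂ (graftTree τ) =
      LinearMap.mul K (OF K) ∘ₗ graftTree τ +
        (LinearMap.mul K (OF K)).compl₂ (graftTree τ) by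
    simpa using congr($h x y)
  refine linearMap_ext fun ω₁ => linearMap_ext fun ω₂ => ?_
  simp only [LinearMap.compr₂_apply, LinearMap.mul_apply', LinearMap.add_apply,
    LinearMap.comp_apply, LinearMap.compl₂_apply]
  induction ω₁ with
  | nil => simp [basisForest_nil, graftTree_one]
  | cons t ts ih =>
    rw [← basisForest_append, List.cons_append, graftTree_cons τ t (ts ++ ω₂), basisForest_append,
      ih, graftTree_cons τ t ts, basisForest_cons t ts]
    noncomm_ring

theorem mem_of_forall_basisForest (S : Submodule K (OF K)) (h : ∀ ω, basisForest K ω ∈ S)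
    (x : OF K) : x ∈ S := by
  induction x using MonoidAlgebra.induction_linear with
  | zero => exact S.zero_mem
  | add a b ha hb => exact S.add_mem ha hb
  | single w r =>
    have hw : MonoidAlgebra.single w r = r • basisForest K (FreeMonoid.toList w) := by
      simp [basisForest]
    rw [hw]
    exact S.smul_mem r (h _)

/-- Induction along the grafting recursion: a property of forests holds for `τ ω` as soon as it holds
for `ω` and for every forest occurring in `τ ▷ ω`. The induction is on the length of forests, which
grafting does not change. -/
theorem Forest.grafting_induction {P : Forest → Prop} (nil : P [])
    (cons : ∀ (τ : PTree) (ω : Forest), P ω → (∀ ω' ∈ Forest.graftings τ ω, P ω') → P (τ :: ω))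
    (ω : Forest) : P ω := by
  induction h : ω.length generalizing ω with
  | zero => rw [List.length_eq_zero_iff.1 h]; exact nil
  | succ n ih =>
    match ω, h with
    | τ :: ω, h =>
      have h' : ω.length = n := by simpa using h
      exact cons τ ω (ih ω h') fun ω' hω' =>
        ih ω' ((Forest.length_of_mem_graftings τ ω ω' hω').trans h')

theorem graftTree_basisForest_mem {S : Submodule K (OF K)} {τ : PTree} {ω : Forest}
    (h : ∀ ω' ∈ Forest.graftings τ ω, basisForest K ω' ∈ S) :
    graftTree τ (basisForest K ω) ∈ S := by
  rw [graftTree_basisForest]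
  refine list_sum_mem fun y hy => ?_
  obtain ⟨ω', hω', rfl⟩ := List.mem_map.1 hy
  exact h ω' hω'

/-- The grafting induction for subspaces. -/
theorem grafting_induction (S : Submodule K (OF K)) (one : 1 ∈ S)
    (tree_mul : ∀ (τ : PTree), ∀ x ∈ S, graftTree τ x ∈ S → basisForest K [τ] * x ∈ S)
    (x : OF K) : x ∈ S := by
  refine mem_of_forall_basisForest S (fun ω => ?_) x
  induction ω using Forest.grafting_induction with
  | nil => exact one
  | cons τ ω h1 h2 =>
    rw [basisForest_cons]
    exact tree_mul τ _ h1 (graftTree_basisForest_mem h2)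

@[simp]
theorem graft_basisForest (ω : Forest) : graft (basisForest K ω) = graftForest ω := by
  simp [graft]

theorem graft_basisForest_singleton (τ : PTree) :
    graft (basisForest K [τ]) = graftTree τ := by
  simp [graftForest, Forest.graftings]

/-- A linear map `ρ` from ordered forests to the endomorphisms of a vector space which satisfies the
recursion `(τ ω) ↦ ρ(τ) ρ(ω) - ρ(τ ▷ ω)` that defines left grafting. Such a map is the same thing as a
representation of the Grossman--Larson algebra, and is determined by its values on trees. -/
structure IsGraftingRep {V : Type*} [AddCommGroup V] [Module K V]
    (ρ : OF K →ₗ[K] Module.End K V) : Prop where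
  map_one : ρ 1 = 1
  map_tree_mul : ∀ (τ : PTree) (x : OF K),
    ρ (basisForest K [τ] * x) = ρ (basisForest K [τ]) * ρ x - ρ (graftTree τ x)

section IsGraftingRep

variable {V W : Type*} [AddCommGroup V] [Module K V] [AddCommGroup W] [Module K W]

theorem IsGraftingRep.of_basisForest {ρ : OF K →ₗ[K] Module.End K V} (h1 : ρ 1 = 1)
    (h : ∀ (τ : PTree) (ω : Forest), ρ (basisForest K (τ :: ω)) =
      ρ (basisForest K [τ]) * ρ (basisForest K ω) - ρ (graftTree τ (basisForest K ω))) :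
    IsGraftingRep ρ := by
  refine ⟨h1, fun τ x => ?_⟩
  suffices h : ρ ∘ₗ LinearMap.mulLeft K (basisForest K [τ]) =
      LinearMap.mulLeft K (ρ (basisForest K [τ])) ∘ₗ ρ - ρ ∘ₗ graftTree τ by
    simpa using congr($h x)
  refine linearMap_ext fun ω => ?_
  simpa [basisForest_cons τ ω] using h τ ω

theorem isGraftingRep_graft : IsGraftingRep (graft : OF K →ₗ[K] Module.End K (OF K)) := by
  refine .of_basisForest ?_ fun τ ω => ?_
  · rw [← basisForest_nil, graft_basisForest, graftForest]; rfl
  · rw [graft_basisForest_singleton, graft_basisForest, graft_basisForest, graftForest,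
      graftTree_basisForest, map_list_sum, List.map_map]
    congr 2
    simp [Function.comp_def, List.attach_map_val (f := fun ω' => graftForest (K := K) ω')]

/-- A linear map that intertwines two grafting representations on trees intertwines them. -/
theorem IsGraftingRep.intertwine {ρ : OF K →ₗ[K] Module.End K V} {σ : OF K →ₗ[K] Module.End K W}
    (hρ : IsGraftingRep ρ) (hσ : IsGraftingRep σ) (f : V →ₗ[K] W)
    (h : ∀ τ v, f (ρ (basisForest K [τ]) v) = σ (basisForest K [τ]) (f v)) (x : OF K) (v : V) :
    f (ρ x v) = σ x (f v) := by
  suffices h : x ∈ LinearMap.eqLocus (ρ.compr₂ f) (σ.compl₂ f) from congr($h v)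
  refine grafting_induction _ ?_ (fun τ x hx hτx => ?_) x
  · ext1; simp [hρ.map_one, hσ.map_one]
  · rw [LinearMap.mem_eqLocus, LinearMap.ext_iff] at *
    intro v
    simp only [LinearMap.compr₂_apply, LinearMap.compl₂_apply] at *
    rw [hρ.map_tree_mul, hσ.map_tree_mul]
    simp only [LinearMap.sub_apply, Module.End.mul_apply, map_sub, h, hx, hτx]

end IsGraftingRep

/-! ### The unshuffle coproduct -/

/-- The unshuffle coproduct, dual to the shuffle product: the algebra morphism for which the trees are
primitive. -/
def unshuffle (K : Type*) [Field K] : OF K →ₐ[K] OF K ⊗[K] OF K :=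
  MonoidAlgebra.lift K (OF K ⊗[K] OF K) (FreeMonoid PTree)
    (FreeMonoid.lift fun τ => basisForest K [τ] ⊗ₜ[K] 1 + 1 ⊗ₜ[K] basisForest K [τ])

/-- Primitive elements for the unshuffle coproduct. -/
def IsPrimitive (x : OF K) : Prop := unshuffle K x = x ⊗ₜ[K] 1 + 1 ⊗ₜ[K] x

theorem isPrimitive_tree (τ : PTree) : IsPrimitive (basisForest K [τ]) := by
  simp [IsPrimitive, unshuffle, basisForest, MonoidAlgebra.lift_single]

theorem isPrimitive_graftTree_tree (τ t : PTree) :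
    IsPrimitive (graftTree τ (basisForest K [t])) := by
  rw [graftTree_basisForest, Forest.graftings]
  simp only [Forest.graftings, List.map_nil, List.append_nil, List.map_map]
  induction PTree.graftings τ t with
  | nil => simp [IsPrimitive]
  | cons a l ih =>
    have := isPrimitive_tree (K := K) a
    simp only [IsPrimitive, List.map_cons, List.sum_cons, map_add, Function.comp_apply,
      TensorProduct.add_tmul, TensorProduct.tmul_add] at ih this ⊢
    rw [ih, this]; abel

/-- The endomorphism `f ⊗ 1 + 1 ⊗ g` of `V ⊗ W`, by which a primitive element acts on a tensor
product. -/
def leibniz {V W : Type*} [AddCommGroup V] [Module K V] [AddCommGroup W] [Module K W]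
    (f : Module.End K V) (g : Module.End K W) : Module.End K (V ⊗[K] W) :=
  TensorProduct.map f LinearMap.id + TensorProduct.map LinearMap.id g

@[simp]
theorem leibniz_tmul {V W : Type*} [AddCommGroup V] [Module K V] [AddCommGroup W] [Module K W]
    (f : Module.End K V) (g : Module.End K W) (v : V) (w : W) :
    leibniz f g (v ⊗ₜ[K] w) = f v ⊗ₜ[K] w + v ⊗ₜ[K] g w := by
  simp [leibniz]

theorem leibniz_mul (f : Module.End K (OF K)) (hf : ∀ x y, f (x * y) = f x * y + x * f y)
    (z w : OF K ⊗[K] OF K) :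
    leibniz f f (z * w) = leibniz f f z * w + z * leibniz f f w := by
  suffices h : (LinearMap.mul K (OF K ⊗[K] OF K)).compr₂ (leibniz f f) =
      LinearMap.mul K (OF K ⊗[K] OF K) ∘ₗ leibniz f f +
        (LinearMap.mul K (OF K ⊗[K] OF K)).compl₂ (leibniz f f) by
    simpa using congr($h z w)
  refine TensorProduct.ext' fun x y => TensorProduct.ext' fun x' y' => ?_
  simp [hf, TensorProduct.add_tmul, TensorProduct.tmul_add, mul_add]
  abel

theorem leibniz_mulLeft (x : OF K) (z : OF K ⊗[K] OF K) :
    leibniz (LinearMap.mulLeft K x) (LinearMap.mulLeft K x) z =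
      (x ⊗ₜ[K] 1 + 1 ⊗ₜ[K] x) * z := by
  induction z with
  | zero => simp
  | add a b ha hb => rw [map_add, ha, hb, mul_add]
  | tmul a b => simp [add_mul]

/-- Grafting a tree is a coderivation. -/
theorem unshuffle_graftTree (τ : PTree) (x : OF K) :
    unshuffle K (graftTree τ x) = leibniz (graftTree τ) (graftTree τ) (unshuffle K x) := by
  suffices h : (unshuffle K).toLinearMap ∘ₗ graftTree τ =
      leibniz (graftTree τ) (graftTree τ) ∘ₗ (unshuffle K).toLinearMap from congr($h x)
  refine linearMap_ext fun ω => ?_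
  simp only [LinearMap.comp_apply, AlgHom.toLinearMap_apply]
  induction ω with
  | nil => simp [basisForest_nil, graftTree_one, Algebra.TensorProduct.one_def]
  | cons t ts ih =>
    rw [basisForest_cons, graftTree_mul, map_add, map_mul, map_mul, map_mul,
      leibniz_mul _ (graftTree_mul τ), ih, isPrimitive_graftTree_tree τ t, isPrimitive_tree t]
    simp [graftTree_one]

section TensorRep

variable {V W : Type*} [AddCommGroup V] [Module K V] [AddCommGroup W] [Module K W]

/-- The linear map `x ⊗ y ↦ ρ(x) ⊗ σ(y)`, with values in the endomorphisms of `V ⊗ W`. -/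
def outer (ρ : OF K →ₗ[K] Module.End K V) (σ : OF K →ₗ[K] Module.End K W) :
    OF K ⊗[K] OF K →ₗ[K] Module.End K (V ⊗[K] W) :=
  TensorProduct.homTensorHomMap (RingHom.id K) V W V W ∘ₗ TensorProduct.map ρ σ

@[simp]
theorem outer_tmul_tmul (ρ : OF K →ₗ[K] Module.End K V) (σ : OF K →ₗ[K] Module.End K W)
    (x y : OF K) (v : V) (w : W) :
    outer ρ σ (x ⊗ₜ[K] y) (v ⊗ₜ[K] w) = ρ x v ⊗ₜ[K] σ y w := by
  simp [outer]

/-- The tensor product of two grafting representations. -/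
def tensorRep (ρ : OF K →ₗ[K] Module.End K V) (σ : OF K →ₗ[K] Module.End K W) :
    OF K →ₗ[K] Module.End K (V ⊗[K] W) :=
  outer ρ σ ∘ₗ (unshuffle K).toLinearMap

theorem tensorRep_apply_of_isPrimitive {ρ : OF K →ₗ[K] Module.End K V}
    {σ : OF K →ₗ[K] Module.End K W} (hρ : IsGraftingRep ρ) (hσ : IsGraftingRep σ) {x : OF K}
    (hx : IsPrimitive x) : tensorRep ρ σ x = leibniz (ρ x) (σ x) := by
  ext v w
  simp only [tensorRep, LinearMap.comp_apply, AlgHom.toLinearMap_apply]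
  rw [hx]
  simp [hρ.map_one, hσ.map_one]

theorem IsGraftingRep.tensorRep {ρ : OF K →ₗ[K] Module.End K V}
    {σ : OF K →ₗ[K] Module.End K W} (hρ : IsGraftingRep ρ) (hσ : IsGraftingRep σ) :
    IsGraftingRep (tensorRep ρ σ) := by
  constructor
  · ext v w
    simp [LieButcher.tensorRep, Algebra.TensorProduct.one_def, hρ.map_one, hσ.map_one]
  · intro τ x
    rw [tensorRep_apply_of_isPrimitive hρ hσ (isPrimitive_tree τ)]
    simp only [LieButcher.tensorRep, LinearMap.comp_apply, AlgHom.toLinearMap_apply, map_mul,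
      unshuffle_graftTree]
    rw [isPrimitive_tree τ]
    induction (unshuffle K x : OF K ⊗[K] OF K) with
    | zero => simp
    | add a b ha hb => rw [mul_add, map_add, ha, hb, map_add, map_add, map_add, mul_add]; abel
    | tmul a b =>
      ext v w
      simp [add_mul, hρ.map_tree_mul, hσ.map_tree_mul, TensorProduct.sub_tmul,
        TensorProduct.tmul_sub]
      abel

end TensorRep

/-! ### The planar Grossman--Larson product -/

theorem graftTree_node (τ : PTree) (ω : Forest) :
    graftTree τ (basisForest K [.node ω]) =
      basisForest K [.node (τ :: ω)] +
        ((Forest.graftings τ ω).map fun ω' => basisForest K [.node ω']).sum := by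
  simp [graftTree_basisForest, Forest.graftings, PTree.graftings, Function.comp_def]

/-- `B⁺` joins the trees of a forest to a common root. -/
theorem Bplus_basisForest (ω : Forest) :
    Bplus (basisForest K ω) = basisForest K [.node ω] := by
  let N : OF K →ₗ[K] OF K := linExt fun ω => basisForest K [.node ω]
  suffices h : basisForest K ω ∈ LinearMap.eqLocus Bplus N by
    simpa [N] using LinearMap.mem_eqLocus.1 h
  have hN (τ : PTree) (x : OF K) : graftTree τ (N x) = N (basisForest K [τ] * x) +
      N (graftTree τ x) := by
    suffices h : graftTree τ ∘ₗ N =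
        N ∘ₗ LinearMap.mulLeft K (basisForest K [τ]) + N ∘ₗ graftTree τ from congr($h x)
    refine linearMap_ext fun ω => ?_
    simp only [LinearMap.comp_apply, LinearMap.add_apply, LinearMap.mulLeft_apply, N]
    rw [← basisForest_cons, linExt_basisForest, linExt_basisForest, graftTree_node,
      graftTree_basisForest, map_list_sum, List.map_map]
    simp [Function.comp_def]
  refine grafting_induction _ ?_ (fun τ x hx hτx => ?_) _
  · rw [LinearMap.mem_eqLocus, ← basisForest_nil]
    simp only [N, linExt_basisForest, Bplus, LinearMap.flip_apply]
    rw [basisForest_nil, isGraftingRep_graft.map_one]; rfl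
  · rw [LinearMap.mem_eqLocus] at *
    rw [eq_sub_of_add_eq (hN τ x).symm, ← hx, ← hτx]
    simp only [Bplus, LinearMap.flip_apply]
    rw [isGraftingRep_graft.map_tree_mul, graft_basisForest_singleton]
    rfl

theorem Bminus_Bplus (x : OF K) : Bminus (Bplus x) = x := by
  suffices h : Bminus ∘ₗ Bplus = (LinearMap.id : OF K →ₗ[K] OF K) from congr($h x)
  refine linearMap_ext fun ω => ?_
  simp [Bplus_basisForest, Bminus]

theorem graftTree_Bplus (τ : PTree) (x : OF K) :
    graftTree τ (Bplus x) = Bplus (basisForest K [τ] * x + graftTree τ x) := by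
  suffices h : graftTree τ ∘ₗ Bplus =
      Bplus ∘ₗ (LinearMap.mulLeft K (basisForest K [τ]) + graftTree τ) by simpa using congr($h x)
  refine linearMap_ext fun ω => ?_
  simp only [LinearMap.comp_apply, Bplus_basisForest, graftTree_node, LinearMap.add_apply,
    LinearMap.mulLeft_apply, map_add]
  rw [← basisForest_cons, Bplus_basisForest, graftTree_basisForest, map_list_sum, List.map_map]
  simp [Function.comp_def, Bplus_basisForest]

theorem graft_Bplus_mem_range (x y : OF K) :
    graft x (Bplus y) ∈ LinearMap.range (Bplus (K := K)) := by
  suffices h : x ∈ (LinearMap.range (Bplus (K := K))).comap (graft.flip (Bplus y)) from h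
  refine grafting_induction _ ?_ (fun τ x hx hτx => ?_) x
  · exact ⟨y, by rw [LinearMap.flip_apply, isGraftingRep_graft.map_one]; rfl⟩
  · rw [Submodule.mem_comap, LinearMap.flip_apply] at *
    obtain ⟨z, hz⟩ := hx
    rw [isGraftingRep_graft.map_tree_mul, LinearMap.sub_apply, Module.End.mul_apply, ← hz,
      graft_basisForest_singleton, graftTree_Bplus]
    exact Submodule.sub_mem _ ⟨_, rfl⟩ hτx

/-- The Grossman--Larson product as a bilinear map. -/
def glMul : OF K →ₗ[K] Module.End K (OF K) :=
  ((graft (K := K)).compl₂ Bplus).compr₂ Bminus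

theorem glMul_apply (x y : OF K) : glMul x y = grossmanLarson x y := rfl

theorem Bplus_glMul (x y : OF K) : Bplus (glMul x y) = graft x (Bplus y) := by
  obtain ⟨z, hz⟩ := graft_Bplus_mem_range x y
  rw [glMul_apply, grossmanLarson, ← hz, Bminus_Bplus]

theorem Bplus_injective : Function.Injective (Bplus : OF K →ₗ[K] OF K) :=
  Function.LeftInverse.injective Bminus_Bplus

theorem glMul_tree (τ : PTree) (x : OF K) :
    glMul (basisForest K [τ]) x = basisForest K [τ] * x + graftTree τ x := by
  apply Bplus_injective
  rw [Bplus_glMul, graft_basisForest_singleton, graftTree_Bplus]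

theorem isGraftingRep_glMul : IsGraftingRep (glMul : OF K →ₗ[K] Module.End K (OF K)) where
  map_one := by
    refine LinearMap.ext fun x => ?_
    apply Bplus_injective
    rw [Bplus_glMul, isGraftingRep_graft.map_one]; rfl
  map_tree_mul τ x := by
    refine LinearMap.ext fun y => ?_
    apply Bplus_injective
    rw [LinearMap.sub_apply, Module.End.mul_apply, map_sub]
    simp only [Bplus_glMul]
    rw [isGraftingRep_graft.map_tree_mul]; rfl

/-- Every grafting representation is a representation of the Grossman--Larson algebra. -/
theorem IsGraftingRep.map_glMul {V : Type*} [AddCommGroup V] [Module K V]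
    {ρ : OF K →ₗ[K] Module.End K V} (hρ : IsGraftingRep ρ) (x y : OF K) :
    ρ (glMul x y) = ρ x * ρ y := by
  have hσ : IsGraftingRep (LinearMap.mul K (Module.End K V) ∘ₗ ρ) := by
    constructor
    · ext; simp [hρ.map_one]
    · intro τ x; ext; simp [hρ.map_tree_mul]
  refine isGraftingRep_glMul.intertwine hσ ρ (fun τ v => ?_) x y
  rw [glMul_tree, map_add, hρ.map_tree_mul]
  simp

theorem glMul_one_right (x : OF K) : glMul x 1 = x := by
  suffices h : x ∈ LinearMap.eqLocus (glMul.flip 1) (LinearMap.id : OF K →ₗ[K] OF K) from h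
  refine grafting_induction _ ?_ (fun τ x hx hτx => ?_) x
  · rw [LinearMap.mem_eqLocus, LinearMap.flip_apply, isGraftingRep_glMul.map_one]; rfl
  · simp only [LinearMap.mem_eqLocus, LinearMap.flip_apply, LinearMap.id_apply] at *
    rw [isGraftingRep_glMul.map_tree_mul, LinearMap.sub_apply, Module.End.mul_apply, hx, hτx,
      glMul_tree, add_sub_cancel_right]

/-- The Grossman--Larson product is compatible with the unshuffle coproduct. -/
theorem unshuffle_glMul (x y : OF K) :
    unshuffle K (glMul x y) = outer glMul glMul (unshuffle K x) (unshuffle K y) := by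
  refine isGraftingRep_glMul.intertwine (isGraftingRep_glMul.tensorRep isGraftingRep_glMul)
    (unshuffle K).toLinearMap (fun τ v => ?_) x y
  rw [tensorRep_apply_of_isPrimitive isGraftingRep_glMul isGraftingRep_glMul (isPrimitive_tree τ)]
  have h : glMul (basisForest K [τ]) = LinearMap.mulLeft K (basisForest K [τ]) + graftTree τ := by
    refine LinearMap.ext fun x => ?_
    simp [glMul_tree]
  have h2 : leibniz (glMul (basisForest K [τ])) (glMul (basisForest K [τ])) =
      leibniz (LinearMap.mulLeft K (basisForest K [τ])) (LinearMap.mulLeft K (basisForest K [τ]))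
        + leibniz (graftTree τ) (graftTree τ) := by
    rw [h]
    simp only [leibniz, TensorProduct.map_add_left, TensorProduct.map_add_right]
    abel
  rw [h2, glMul_tree, LinearMap.add_apply, leibniz_mulLeft]
  simp only [AlgHom.toLinearMap_apply, map_add, map_mul, unshuffle_graftTree]
  rw [isPrimitive_tree τ]

/-- Grafting acts on a product through the unshuffle coproduct. -/
theorem graft_mul (x y z : OF K) :
    graft x (y * z) =
      LinearMap.mul' K (OF K) (outer graft graft (unshuffle K x) (y ⊗ₜ[K] z)) := by
  refine ((isGraftingRep_graft.tensorRep isGraftingRep_graft).intertwine isGraftingRep_graft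
    (LinearMap.mul' K (OF K)) (fun τ v => ?_) x (y ⊗ₜ[K] z)).symm
  rw [tensorRep_apply_of_isPrimitive isGraftingRep_graft isGraftingRep_graft (isPrimitive_tree τ),
    graft_basisForest_singleton]
  induction v with
  | zero => simp
  | add a b ha hb => simp only [map_add, ha, hb]
  | tmul a b => simp [graftTree_mul]

/-- The Grossman--Larson product in terms of concatenation and grafting: for `y = 1` this is
`x ⋄ z = ∑ x₁ (x₂ ▷ z)`, where `Δ x = ∑ x₁ ⊗ x₂`. -/
theorem glMul_mul (x y z : OF K) :
    glMul x (y * z) =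
      LinearMap.mul' K (OF K) (outer glMul graft (unshuffle K x) (y ⊗ₜ[K] z)) := by
  refine ((isGraftingRep_glMul.tensorRep isGraftingRep_graft).intertwine isGraftingRep_glMul
    (LinearMap.mul' K (OF K)) (fun τ v => ?_) x (y ⊗ₜ[K] z)).symm
  rw [tensorRep_apply_of_isPrimitive isGraftingRep_glMul isGraftingRep_graft (isPrimitive_tree τ),
    graft_basisForest_singleton]
  induction v with
  | zero => simp
  | add a b ha hb => simp only [map_add, ha, hb]
  | tmul a b => simp [glMul_tree, graftTree_mul, mul_assoc, add_mul, add_assoc]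

/-- Grafting a primitive element is a derivation. -/
theorem IsPrimitive.graft_mul {x : OF K} (hx : IsPrimitive x) (y z : OF K) :
    graft x (y * z) = graft x y * z + y * graft x z := by
  rw [LieButcher.graft_mul, hx]
  simp [isGraftingRep_graft.map_one]

theorem IsPrimitive.glMul {x : OF K} (hx : IsPrimitive x) (y : OF K) :
    glMul x y = x * y + graft x y := by
  have := glMul_mul x 1 y
  rw [one_mul, hx] at this
  simpa [isGraftingRep_graft.map_one, isGraftingRep_glMul.map_one, glMul_one_right] using this

/-! ### Lie polynomials -/

theorem isPrimitive_of_mem_LiePT {x : OF K} (hx : x ∈ LiePT K) : IsPrimitive x := by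
  induction hx using LieSubalgebra.lieSpan_induction with
  | mem x h => obtain ⟨τ, rfl⟩ := h; exact isPrimitive_tree τ
  | zero => simp [IsPrimitive]
  | add x y _ _ hx hy =>
    rw [IsPrimitive] at *
    rw [map_add, hx, hy, TensorProduct.add_tmul, TensorProduct.tmul_add]; abel
  | smul a x _ hx =>
    rw [IsPrimitive] at *
    rw [map_smul, hx, smul_add, TensorProduct.smul_tmul', TensorProduct.tmul_smul]
  | lie x y _ _ hx hy =>
    rw [IsPrimitive] at *
    rw [LieRing.of_associative_ring_bracket, map_sub, map_mul, map_mul, hx, hy]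
    simp only [add_mul, mul_add, Algebra.TensorProduct.tmul_mul_tmul, one_mul, mul_one,
      TensorProduct.sub_tmul, TensorProduct.tmul_sub]
    abel

theorem tree_mem_LiePT (τ : PTree) : basisForest K [τ] ∈ LiePT K :=
  LieSubalgebra.subset_lieSpan ⟨τ, rfl⟩

theorem graftTree_mem_LiePT (τ : PTree) {x : OF K} (hx : x ∈ LiePT K) :
    graftTree τ x ∈ LiePT K := by
  induction hx using LieSubalgebra.lieSpan_induction with
  | mem x h =>
    obtain ⟨t, rfl⟩ := h
    rw [graftTree_basisForest]
    refine list_sum_mem fun y hy => ?_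
    simp only [Forest.graftings, List.map_nil, List.append_nil, List.map_map, List.mem_map] at hy
    obtain ⟨t', _, rfl⟩ := hy
    exact tree_mem_LiePT t'
  | zero => rw [map_zero]; exact zero_mem _
  | add x y _ _ hx hy => rw [map_add]; exact add_mem hx hy
  | smul a x _ hx => rw [map_smul]; exact (LiePT K).smul_mem a hx
  | lie x y hx' hy' hx hy =>
    have : graftTree τ ⁅x, y⁆ = ⁅graftTree τ x, y⁆ + ⁅x, graftTree τ y⁆ := by
      simp only [LieRing.of_associative_ring_bracket, map_sub, graftTree_mul]
      abel
    rw [this]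
    exact add_mem ((LiePT K).lie_mem hx hy') ((LiePT K).lie_mem hx' hy)

/-- Lie polynomials form a left ideal for grafting. -/
theorem graft_mem_LiePT (x : OF K) {y : OF K} (hy : y ∈ LiePT K) : graft x y ∈ LiePT K := by
  suffices h : x ∈ (LiePT K).toSubmodule.comap (graft.flip y) from h
  refine grafting_induction _ ?_ (fun τ x hx hτx => ?_) x
  · rw [Submodule.mem_comap, LinearMap.flip_apply, isGraftingRep_graft.map_one]
    exact hy
  · rw [Submodule.mem_comap, LinearMap.flip_apply] at *
    rw [isGraftingRep_graft.map_tree_mul, graft_basisForest_singleton]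
    exact sub_mem (graftTree_mem_LiePT τ hx) hτx

/-! ### Substitution of a Lie polynomial for the vertex -/

theorem Forest.node_cons_induction {P : Forest → Prop} (nil : P [])
    (node_cons : ∀ ts ω : Forest, P ts → P ω → P (.node ts :: ω)) : ∀ ω : Forest, P ω
  | [] => nil
  | .node ts :: ω => node_cons ts ω (node_cons_induction nil node_cons ts)
      (node_cons_induction nil node_cons ω)

theorem forestSubst_node_cons (f : ℕ → OF K) (k : ℕ) (ts ω : Forest) :
    forestSubst f k (.node ts :: ω) =
      graft (forestSubst f (k + 1) ts) (f k) *
        forestSubst f (k + (Forest.vertices ts + 1)) ω := by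
  simp [forestSubst, treeSubst, PTree.vertices]

theorem vertices_node_cons (ts ω : Forest) :
    Forest.vertices (.node ts :: ω) = Forest.vertices ts + 1 + Forest.vertices ω := by
  simp [Forest.vertices, PTree.vertices]

/-- `forestSubst f k ω` depends only on the values of `f` at the labels of the vertices of `ω`. -/
theorem forestSubst_congr (ω : Forest) {f g : ℕ → OF K} {k l : ℕ}
    (h : ∀ i < Forest.vertices ω, f (k + i) = g (l + i)) :
    forestSubst f k ω = forestSubst g l ω := by
  induction ω using Forest.node_cons_induction generalizing k l with
  | nil => simp [forestSubst]
  | node_cons ts ω ih1 ih2 =>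
    rw [vertices_node_cons] at h
    have h0 : f k = g l := by simpa using h 0 (by omega)
    rw [forestSubst_node_cons, forestSubst_node_cons, ih1 (l := l + 1),
      ih2 (l := l + (Forest.vertices ts + 1)), h0]
    · intro i hi
      simpa only [add_assoc] using h (Forest.vertices ts + 1 + i) (by omega)
    · intro i hi
      simpa only [add_assoc] using h (1 + i) (by omega)

/-- The algebra endomorphism which replaces every vertex of a forest by `L`, in the expression of the
forest through concatenation and grafting. -/
def subst (L : OF K) : OF K →ₐ[K] OF K :=
  MonoidAlgebra.lift K (OF K) (FreeMonoid PTree) (FreeMonoid.lift (treeSubst (fun _ => L) 0))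

theorem subst_basisForest (L : OF K) (k : ℕ) (ω : Forest) :
    subst L (basisForest K ω) = forestSubst (fun _ => L) k ω := by
  induction ω generalizing k with
  | nil => simp [basisForest_nil, forestSubst]
  | cons τ ω ih =>
    obtain ⟨ts⟩ := τ
    rw [basisForest_cons, map_mul, ih, forestSubst_node_cons]
    congr 1
    simp only [subst, basisForest, MonoidAlgebra.lift_single, one_smul, FreeMonoid.ofList_singleton,
      FreeMonoid.lift_eval_of, treeSubst]
    rw [forestSubst_congr ts (g := fun _ => L) (k := 0 + 1) (l := k + 1) fun _ _ => rfl]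

theorem subst_Bplus (L x : OF K) : subst L (Bplus x) = graft (subst L x) L := by
  suffices h : (subst L).toLinearMap ∘ₗ Bplus = graft.flip L ∘ₗ (subst L).toLinearMap from
    congr($h x)
  refine linearMap_ext fun ω => ?_
  simp only [LinearMap.comp_apply, AlgHom.toLinearMap_apply, LinearMap.flip_apply]
  rw [Bplus_basisForest, subst_basisForest L 0, forestSubst_node_cons, subst_basisForest L (0 + 1)]
  simp [forestSubst]

theorem subst_tree_mem_LiePT {L : OF K} (hL : L ∈ LiePT K) (τ : PTree) :
    subst L (basisForest K [τ]) ∈ LiePT K := by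
  obtain ⟨ts⟩ := τ
  rw [← Bplus_basisForest, subst_Bplus]
  exact graft_mem_LiePT _ hL

/-- The substitution of a Lie polynomial is a coalgebra morphism. -/
theorem unshuffle_subst {L : OF K} (hL : L ∈ LiePT K) (x : OF K) :
    unshuffle K (subst L x) =
      TensorProduct.map (subst L).toLinearMap (subst L).toLinearMap (unshuffle K x) := by
  suffices h : (unshuffle K).comp (subst L) =
      (Algebra.TensorProduct.map (subst L) (subst L)).comp (unshuffle K) from congr($h x)
  refine AlgHom.toLinearMap_injective (linearMap_ext fun ω => ?_)
  simp only [AlgHom.toLinearMap_apply]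
  induction ω with
  | nil => rw [basisForest_nil, map_one, map_one]
  | cons τ ω ih =>
    rw [basisForest_cons, map_mul, map_mul, ih]
    congr 1
    simp only [AlgHom.comp_apply]
    rw [isPrimitive_of_mem_LiePT (subst_tree_mem_LiePT hL τ), isPrimitive_tree τ]
    simp

/-- The substitution of a Lie polynomial commutes with grafting. -/
theorem subst_graftTree {L : OF K} (hL : L ∈ LiePT K) (τ : PTree) (x : OF K) :
    subst L (graftTree τ x) = graft (subst L (basisForest K [τ])) (subst L x) := by
  have hT := isPrimitive_of_mem_LiePT (subst_tree_mem_LiePT hL τ)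
  set T := subst L (basisForest K [τ]) with hTdef
  suffices hx : (subst L).toLinearMap ∘ₗ graftTree τ = graft T ∘ₗ (subst L).toLinearMap from
    congr($hx x)
  refine linearMap_ext fun ω => ?_
  simp only [LinearMap.comp_apply, AlgHom.toLinearMap_apply]
  induction ω using Forest.node_cons_induction with
  | nil =>
    rw [basisForest_nil, graftTree_one, map_zero, map_one]
    have h : graft T 1 = 0 := by simpa using hT.graft_mul 1 1
    exact h.symm
  | node_cons ts ω ih1 ih2 =>
    rw [basisForest_cons, graftTree_mul, map_add, map_mul, map_mul, map_mul, hT.graft_mul, ih2,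
      ← Bplus_basisForest, graftTree_Bplus, subst_Bplus, subst_Bplus, map_add, map_mul, ← hTdef,
      ih1, ← hT.glMul, isGraftingRep_graft.map_glMul]
    rfl

/-- The substitution of a Lie polynomial is a morphism for the Grossman--Larson product. -/
theorem subst_glMul {L : OF K} (hL : L ∈ LiePT K) (x y : OF K) :
    subst L (glMul x y) = glMul (subst L x) (subst L y) := by
  have hT (τ : PTree) (y : OF K) : subst L (basisForest K [τ]) * subst L y =
      glMul (subst L (basisForest K [τ])) (subst L y) - subst L (graftTree τ y) := by
    rw [(isPrimitive_of_mem_LiePT (subst_tree_mem_LiePT hL τ)).glMul, subst_graftTree hL,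
      add_sub_cancel_right]
  have hσ : IsGraftingRep (glMul ∘ₗ (subst L).toLinearMap) := by
    constructor
    · simp [isGraftingRep_glMul.map_one]
    · intro τ x
      simp only [LinearMap.comp_apply, AlgHom.toLinearMap_apply, map_mul]
      rw [hT, map_sub, isGraftingRep_glMul.map_glMul]
  refine isGraftingRep_glMul.intertwine hσ (subst L).toLinearMap (fun τ v => ?_) x y
  simp only [LinearMap.comp_apply, AlgHom.toLinearMap_apply]
  rw [glMul_tree, map_add, map_mul, hT, sub_add_cancel]

/-! ### Multilinearity of the substitution -/

theorem forestSubst_update_of_notMem (f : ℕ → OF K) {i k : ℕ} (x : OF K) {ω : Forest}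
    (h : i < k ∨ k + Forest.vertices ω ≤ i) :
    forestSubst (Function.update f i x) k ω = forestSubst f k ω :=
  forestSubst_congr ω fun j hj => Function.update_of_ne (by omega) ..

/-- Each vertex occurs exactly once, so that the substitution is linear in the element put at it. -/
theorem exists_forestSubst_update (f : ℕ → OF K) {i k : ℕ} {ω : Forest} (hk : k ≤ i)
    (hi : i < k + Forest.vertices ω) :
    ∃ φ : OF K →ₗ[K] OF K, ∀ x, forestSubst (Function.update f i x) k ω = φ x := by
  induction ω using Forest.node_cons_induction generalizing k with
  | nil => simp [Forest.vertices] at hi; omega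
  | node_cons ts ω ih1 ih2 =>
    rw [vertices_node_cons] at hi
    simp only [forestSubst_node_cons]
    rcases lt_or_ge i (k + (Forest.vertices ts + 1)) with h | h
    · simp only [forestSubst_update_of_notMem f (ω := ω) _ (Or.inl h)]
      rcases hk.eq_or_lt with rfl | hk'
      · refine ⟨LinearMap.mulRight K (forestSubst f (k + (Forest.vertices ts + 1)) ω) ∘ₗ
          graft (forestSubst f (k + 1) ts), fun x => ?_⟩
        rw [forestSubst_update_of_notMem f _ (Or.inl (Nat.lt_succ_self k))]
        simp
      · obtain ⟨φ, hφ⟩ := ih1 (k := k + 1) hk' (by omega)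
        refine ⟨LinearMap.mulRight K (forestSubst f (k + (Forest.vertices ts + 1)) ω) ∘ₗ
          graft.flip (f k) ∘ₗ φ, fun x => ?_⟩
        rw [hφ, Function.update_of_ne hk'.ne]
        simp
    · obtain ⟨φ, hφ⟩ := ih2 h (by omega)
      refine ⟨LinearMap.mulLeft K (graft (forestSubst f (k + 1) ts) (f k)) ∘ₗ φ, fun x => ?_⟩
      rw [hφ, Function.update_of_ne (by omega),
        forestSubst_update_of_notMem f (ω := ts) _ (Or.inr (by omega))]
      simp

/-- The substitution into the vertices of a forest with `n` vertices, as a multilinear map. -/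
def substMultilinear {n : ℕ} (ω : ForestOfSize n) :
    MultilinearMap K (fun _ : Fin n => OF K) (OF K) :=
  have key [DecidableEq (Fin n)] (m : Fin n → OF K) (i : Fin n) :
      ∃ φ : OF K →ₗ[K] OF K, ∀ x, forestSubst (fun j => if h : j < n then
        Function.update m i x ⟨j, h⟩ else 0) 0 ω.1 = φ x := by
    obtain ⟨φ, hφ⟩ := exists_forestSubst_update (fun j => if h : j < n then m ⟨j, h⟩ else 0)
      (i := i.1) (k := 0) (ω := ω.1) (Nat.zero_le _) (by rw [ω.2]; omega)
    refine ⟨φ, fun x => ?_⟩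
    rw [← hφ]
    congr 1
    ext1 j
    by_cases hj : j = i.1
    · subst hj; simp
    · rw [Function.update_of_ne hj]
      split_ifs with h
      · rw [Function.update_of_ne (by simpa [Fin.ext_iff] using hj)]
      · rfl
  { toFun := fun m => forestSubst (fun j => if h : j < n then m ⟨j, h⟩ else 0) 0 ω.1
    map_update_add' := fun m i x y => by
      obtain ⟨φ, hφ⟩ := key m i
      simp only [hφ, map_add]
    map_update_smul' := fun m i c x => by
      obtain ⟨φ, hφ⟩ := key m i
      simp only [hφ, map_smul] }

theorem substMultilinear_const {n : ℕ} (ω : ForestOfSize n) (L : OF K) :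
    substMultilinear ω (fun _ => L) = subst L (basisForest K ω.1) := by
  rw [subst_basisForest L 0]
  refine forestSubst_congr _ fun i hi => ?_
  rw [ω.2] at hi
  simp [hi]

theorem compose_eq_substMultilinear {n : ℕ} (x : Fin n → LiePT K) (ω : ForestOfSize n)
    (σ : Equiv.Perm (Fin n)) :
    compose x ω.1 σ = substMultilinear ω (fun i => (x (σ i) : OF K)) := rfl

/-- Polarisation: the sum over all labellings and all families of elements `g j` with coefficients `a j`
is the substitution of `∑ j, a j • g j` for every vertex, up to the number `n!` of labellings. -/
theorem sum_compose {n : ℕ} {J : Type*} [Fintype J] (a : J → K) (g : J → LiePT K)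
    (ω : ForestOfSize n) :
    ∑ σ : Equiv.Perm (Fin n), ∑ c : Fin n → J,
        (∏ i, a (c i)) • compose (fun i => g (c i)) ω.1 σ =
      (n.factorial : K) • subst ((∑ j, a j • g j : LiePT K) : OF K) (basisForest K ω.1) := by
  have h (σ : Equiv.Perm (Fin n)) : ∑ c : Fin n → J,
      (∏ i, a (c i)) • compose (fun i => g (c i)) ω.1 σ =
        subst ((∑ j, a j • g j : LiePT K) : OF K) (basisForest K ω.1) := by
    have hL : ((∑ j, a j • g j : LiePT K) : OF K) = ∑ j, a j • (g j : OF K) := by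
      simp
    rw [← substMultilinear_const, hL, MultilinearMap.map_sum,
      ← (Equiv.arrowCongr σ (Equiv.refl J)).sum_comp]
    refine Finset.sum_congr rfl fun c _ => ?_
    rw [MultilinearMap.map_smul_univ, compose_eq_substMultilinear]
    simp only [Equiv.arrowCongr_apply, Equiv.coe_refl, Function.comp_apply, id,
      Equiv.symm_apply_apply]
    rw [Equiv.prod_comp σ.symm fun i => a (c i)]
  simp only [h, Finset.sum_const, Finset.card_univ, Fintype.card_perm, Fintype.card_fin,
    Nat.cast_smul_eq_nsmul]

/-! ### Coefficients and homogeneity -/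

/-- The forests, as a basis. -/
def forestBasis (K : Type*) [Field K] : Module.Basis Forest K (OF K) :=
  (MonoidAlgebra.basis (FreeMonoid PTree) K).reindex FreeMonoid.toList

theorem forestBasis_apply (ω : Forest) : forestBasis K ω = basisForest K ω := by
  rw [forestBasis, Module.Basis.reindex_apply, MonoidAlgebra.basis_apply]
  rfl

theorem forestBasis_repr (ω : Forest) (x : OF K) : (forestBasis K).repr x ω = coeffAt ω x := rfl

/-- The coefficient of a forest, as a linear form. -/
def coeffLin (ω : Forest) : OF K →ₗ[K] K := (forestBasis K).coord ω

@[simp]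
theorem coeffLin_apply (ω : Forest) (x : OF K) : coeffLin ω x = coeffAt ω x := rfl

open Classical in
theorem coeffAt_basisForest (ω ω' : Forest) :
    coeffAt ω (basisForest K ω') = if ω' = ω then 1 else 0 := by
  rw [← forestBasis_repr, ← forestBasis_apply, Module.Basis.repr_self, Finsupp.single_apply]

@[simp]
theorem coeffAt_zero (ω : Forest) : coeffAt ω (0 : OF K) = 0 := (coeffLin ω).map_zero
@[simp]
theorem coeffAt_add (ω : Forest) (x y : OF K) : coeffAt ω (x + y) = coeffAt ω x + coeffAt ω y :=
  (coeffLin ω).map_add x y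
@[simp]
theorem coeffAt_sub (ω : Forest) (x y : OF K) : coeffAt ω (x - y) = coeffAt ω x - coeffAt ω y :=
  (coeffLin ω).map_sub x y
@[simp]
theorem coeffAt_smul (ω : Forest) (c : K) (x : OF K) : coeffAt ω (c • x) = c * coeffAt ω x :=
  (coeffLin ω).map_smul c x

theorem coeffAt_sum {ι : Type*} (ω : Forest) (s : Finset ι) (f : ι → OF K) :
    coeffAt ω (∑ i ∈ s, f i) = ∑ i ∈ s, coeffAt ω (f i) :=
  map_sum (coeffLin ω) f s

theorem Forest.vertices_append (ω₁ ω₂ : Forest) :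
    Forest.vertices (ω₁ ++ ω₂) = Forest.vertices ω₁ + Forest.vertices ω₂ := by
  induction ω₁ with
  | nil => simp [Forest.vertices]
  | cons t ts ih => simp [Forest.vertices, ih, add_assoc]

theorem Forest.eq_nil_of_vertices_eq_zero {ω : Forest} (h : Forest.vertices ω = 0) : ω = [] := by
  match ω with
  | [] => rfl
  | .node ts :: ω => rw [vertices_node_cons] at h; omega

theorem Forest.eq_leaf_of_vertices_eq_one {ω : Forest} (h : Forest.vertices ω = 1) :
    ω = [PTree.leaf] := by
  match ω with
  | [] => simp [Forest.vertices] at h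
  | .node ts :: ω =>
    rw [vertices_node_cons] at h
    rw [Forest.eq_nil_of_vertices_eq_zero (ω := ts) (by omega),
      Forest.eq_nil_of_vertices_eq_zero (ω := ω) (by omega)]
    rfl

theorem Forest.vertices_of_mem_graftings (τ : PTree) {ω ω' : Forest}
    (h : ω' ∈ Forest.graftings τ ω) :
    Forest.vertices ω' = PTree.vertices τ + Forest.vertices ω := by
  induction ω using Forest.node_cons_induction generalizing ω' with
  | nil => simp [Forest.graftings] at h
  | node_cons ts ω ih1 ih2 =>
    simp only [Forest.graftings, PTree.graftings, List.map_cons, List.map_map, List.mem_append,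
      List.mem_cons, List.mem_map, Function.comp_apply] at h
    rcases h with (rfl | ⟨ts', h, rfl⟩) | ⟨ω'', h, rfl⟩
    · simp only [Forest.vertices, PTree.vertices]; omega
    · rw [vertices_node_cons, vertices_node_cons, ih1 h]; omega
    · rw [vertices_node_cons, vertices_node_cons, ih2 h]; omega

theorem basisForest_mem_homogeneous (ω : Forest) :
    basisForest K ω ∈ homogeneous K (Forest.vertices ω) :=
  Submodule.subset_span ⟨ω, rfl, rfl⟩

theorem coeffAt_eq_zero_of_mem_homogeneous {d : ℕ} {x : OF K} (hx : x ∈ homogeneous K d)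
    {ω : Forest} (h : Forest.vertices ω ≠ d) : coeffAt ω x = 0 := by
  suffices hle : homogeneous K d ≤ LinearMap.ker (coeffLin ω) from hle hx
  refine Submodule.span_le.2 ?_
  rintro _ ⟨ω', rfl, rfl⟩
  have : ω' ≠ ω := by rintro rfl; exact h rfl
  simp [coeffAt_basisForest, this]

theorem apply_mem_of_mem_homogeneous {f : OF K →ₗ[K] OF K} {d : ℕ} {S : Submodule K (OF K)}
    (h : ∀ ω, Forest.vertices ω = d → f (basisForest K ω) ∈ S) {x : OF K}
    (hx : x ∈ homogeneous K d) : f x ∈ S := by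
  suffices hle : homogeneous K d ≤ S.comap f from hle hx
  refine Submodule.span_le.2 ?_
  rintro _ ⟨ω, hω, rfl⟩
  exact h ω hω

theorem basisForest_mul_mem_homogeneous (ω : Forest) {n : ℕ} {x : OF K}
    (hx : x ∈ homogeneous K n) :
    basisForest K ω * x ∈ homogeneous K (Forest.vertices ω + n) := by
  refine apply_mem_of_mem_homogeneous (f := LinearMap.mulLeft K (basisForest K ω)) ?_ hx
  rintro ω' rfl
  rw [LinearMap.mulLeft_apply, ← basisForest_append, ← Forest.vertices_append]
  exact basisForest_mem_homogeneous _

theorem graftTree_mem_homogeneous (τ : PTree) {n : ℕ} {x : OF K} (hx : x ∈ homogeneous K n) :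
    graftTree τ x ∈ homogeneous K (PTree.vertices τ + n) := by
  refine apply_mem_of_mem_homogeneous ?_ hx
  rintro ω rfl
  refine graftTree_basisForest_mem fun ω' hω' => ?_
  rw [← Forest.vertices_of_mem_graftings τ hω']
  exact basisForest_mem_homogeneous _

/-- A grafting representation on forests is graded as soon as the trees act by graded maps. -/
theorem IsGraftingRep.mem_homogeneous {ρ : OF K →ₗ[K] Module.End K (OF K)} (hρ : IsGraftingRep ρ)
    (h : ∀ (τ : PTree) (n : ℕ), ∀ x ∈ homogeneous K n,
      ρ (basisForest K [τ]) x ∈ homogeneous K (PTree.vertices τ + n))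
    (ω : Forest) {n : ℕ} {x : OF K} (hx : x ∈ homogeneous K n) :
    ρ (basisForest K ω) x ∈ homogeneous K (Forest.vertices ω + n) := by
  induction ω using Forest.grafting_induction with
  | nil =>
    rw [basisForest_nil, hρ.map_one, Forest.vertices, zero_add]
    exact hx
  | cons τ ω ih1 ih2 =>
    rw [basisForest_cons, hρ.map_tree_mul, Forest.vertices, add_assoc]
    refine sub_mem (h τ _ _ ih1) ?_
    refine (graftTree_basisForest_mem fun ω' hω' => ?_ : graftTree τ (basisForest K ω) ∈
      (homogeneous K (PTree.vertices τ + (Forest.vertices ω + n))).comap (ρ.flip x))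
    rw [← add_assoc, ← Forest.vertices_of_mem_graftings τ hω']
    exact ih2 ω' hω'

theorem graft_mem_homogeneous (ω : Forest) {n : ℕ} {x : OF K} (hx : x ∈ homogeneous K n) :
    graft (basisForest K ω) x ∈ homogeneous K (Forest.vertices ω + n) :=
  isGraftingRep_graft.mem_homogeneous (fun τ n x hx => by
    rw [graft_basisForest_singleton]; exact graftTree_mem_homogeneous τ hx) ω hx

theorem glMul_mem_homogeneous (ω : Forest) {n : ℕ} {x : OF K} (hx : x ∈ homogeneous K n) :
    glMul (basisForest K ω) x ∈ homogeneous K (Forest.vertices ω + n) :=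
  isGraftingRep_glMul.mem_homogeneous (fun τ n x hx => by
    rw [glMul_tree]
    refine add_mem ?_ (graftTree_mem_homogeneous τ hx)
    simpa [Forest.vertices] using basisForest_mul_mem_homogeneous [τ] hx) ω hx

/-! ### The filtration by the number of vertices -/

/-- The span of the forests with at least `n` vertices. Elements of `OF` modulo this subspace are series
of forests truncated at order `n`. -/
def filtration (K : Type*) [Field K] (n : ℕ) : Submodule K (OF K) :=
  Submodule.span K (basisForest K '' {ω | n ≤ Forest.vertices ω})

theorem basisForest_mem_filtration {ω : Forest} {n : ℕ} (h : n ≤ Forest.vertices ω) :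
    basisForest K ω ∈ filtration K n :=
  Submodule.subset_span ⟨ω, h, rfl⟩

theorem mem_filtration_iff {n : ℕ} {x : OF K} :
    x ∈ filtration K n ↔ ∀ ω, Forest.vertices ω < n → coeffAt ω x = 0 := by
  have h : filtration K n = Submodule.span K (forestBasis K '' {ω | n ≤ Forest.vertices ω}) := by
    simp only [filtration, Set.image, forestBasis_apply]
  rw [h, Module.Basis.mem_span_image]
  refine ⟨fun h ω hω => ?_, fun h ω hω => ?_⟩
  · by_contra hne
    exact absurd (h (Finsupp.mem_support_iff.2 hne)) (by simpa using hω)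
  · by_contra hne
    exact Finsupp.mem_support_iff.1 hω (h ω (by simpa using hne))

theorem filtration_zero : filtration K 0 = ⊤ :=
  eq_top_iff.2 fun _ _ => mem_filtration_iff.2 fun _ h => absurd h (Nat.not_lt_zero _)

theorem filtration_anti {m n : ℕ} (h : m ≤ n) : filtration K n ≤ filtration K m :=
  Submodule.span_mono (Set.image_mono fun _ hω => h.trans hω)

theorem homogeneous_le_filtration (n : ℕ) : homogeneous K n ≤ filtration K n :=
  Submodule.span_le.2 fun _ ⟨_, hω, hx⟩ => hx ▸ basisForest_mem_filtration hω.ge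

theorem apply_mem_of_mem_filtration {V : Type*} [AddCommGroup V] [Module K V] {f : OF K →ₗ[K] V}
    {n : ℕ} {S : Submodule K V} (h : ∀ ω, n ≤ Forest.vertices ω → f (basisForest K ω) ∈ S)
    {x : OF K} (hx : x ∈ filtration K n) : f x ∈ S := by
  suffices hle : filtration K n ≤ S.comap f from hle hx
  refine Submodule.span_le.2 ?_
  rintro _ ⟨ω, hω, rfl⟩
  exact h ω hω

/-- A graded bilinear map is filtered. -/
theorem apply_apply_mem_filtration {B : OF K →ₗ[K] OF K →ₗ[K] OF K}
    (h : ∀ u v, B (basisForest K u) (basisForest K v) ∈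
      homogeneous K (Forest.vertices u + Forest.vertices v))
    {m n : ℕ} {x y : OF K} (hx : x ∈ filtration K m) (hy : y ∈ filtration K n) :
    B x y ∈ filtration K (m + n) := by
  refine LinearMap.BilinMap.apply_apply_mem_of_mem_span _ _ _ B ?_ x y hx hy
  rintro _ ⟨u, hu, rfl⟩ _ ⟨v, hv, rfl⟩
  exact filtration_anti (add_le_add hu hv) (homogeneous_le_filtration _ (h u v))

theorem mul_mem_filtration {m n : ℕ} {x y : OF K} (hx : x ∈ filtration K m)
    (hy : y ∈ filtration K n) : x * y ∈ filtration K (m + n) :=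
  apply_apply_mem_filtration (B := LinearMap.mul K (OF K))
    (fun u v => basisForest_mul_mem_homogeneous u (basisForest_mem_homogeneous v)) hx hy

theorem graft_mem_filtration {m n : ℕ} {x y : OF K} (hx : x ∈ filtration K m)
    (hy : y ∈ filtration K n) : graft x y ∈ filtration K (m + n) :=
  apply_apply_mem_filtration
    (fun u v => graft_mem_homogeneous u (basisForest_mem_homogeneous v)) hx hy

theorem glMul_mem_filtration {m n : ℕ} {x y : OF K} (hx : x ∈ filtration K m)
    (hy : y ∈ filtration K n) : glMul x y ∈ filtration K (m + n) :=
  apply_apply_mem_filtration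
    (fun u v => glMul_mem_homogeneous u (basisForest_mem_homogeneous v)) hx hy

theorem mem_filtration_one_of_mem_LiePT {x : OF K} (hx : x ∈ LiePT K) : x ∈ filtration K 1 := by
  induction hx using LieSubalgebra.lieSpan_induction with
  | mem x h =>
    obtain ⟨⟨ts⟩, rfl⟩ := h
    exact basisForest_mem_filtration (by rw [vertices_node_cons]; omega)
  | zero => exact Submodule.zero_mem _
  | add x y _ _ hx hy => exact Submodule.add_mem _ hx hy
  | smul a x _ hx => exact Submodule.smul_mem _ a hx
  | lie x y _ _ hx hy =>
    rw [LieRing.of_associative_ring_bracket]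
    have h := Submodule.sub_mem _ (mul_mem_filtration hx hy) (mul_mem_filtration hy hx)
    exact filtration_anti one_le_two h

theorem subst_basisForest_node_cons (L : OF K) (ts ω : Forest) :
    subst L (basisForest K (.node ts :: ω)) =
      graft (subst L (basisForest K ts)) L * subst L (basisForest K ω) := by
  rw [basisForest_cons, map_mul, ← Bplus_basisForest, subst_Bplus]

theorem subst_basisForest_mem_filtration {L : OF K} (hL : L ∈ filtration K 1) (ω : Forest) :
    subst L (basisForest K ω) ∈ filtration K (Forest.vertices ω) := by
  induction ω using Forest.node_cons_induction with
  | nil => rw [Forest.vertices, filtration_zero]; trivial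
  | node_cons ts ω ih1 ih2 =>
    rw [subst_basisForest_node_cons, vertices_node_cons]
    exact mul_mem_filtration (graft_mem_filtration ih1 hL) ih2

/-- The substitution is continuous in the substituted element. A vertex contributes degree at least one,
so a change of `L` in degrees above `k` changes the image of `ω` in degrees at least `|ω| + k` only. -/
theorem subst_basisForest_sub_mem_filtration {L L' : OF K} (hL : L ∈ filtration K 1)
    (hL' : L' ∈ filtration K 1) {k : ℕ} (h : L - L' ∈ filtration K (k + 1)) (ω : Forest) :
    subst L (basisForest K ω) - subst L' (basisForest K ω) ∈
      filtration K (Forest.vertices ω + k) := by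
  induction ω using Forest.node_cons_induction with
  | nil => simp [basisForest_nil]
  | node_cons ts ω ih1 ih2 =>
    rw [subst_basisForest_node_cons, subst_basisForest_node_cons, vertices_node_cons]
    set s := subst L (basisForest K ts)
    set s' := subst L' (basisForest K ts)
    set w := subst L (basisForest K ω) with hw
    set w' := subst L' (basisForest K ω)
    have hs' : s' ∈ filtration K (Forest.vertices ts) := subst_basisForest_mem_filtration hL' ts
    have e : graft s L * w - graft s' L' * w' =
        graft (s - s') L * w + graft s' (L - L') * w + graft s' L' * (w - w') := by
      simp only [map_sub, LinearMap.sub_apply]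
      noncomm_ring
    rw [e]
    refine add_mem (add_mem ?_ ?_) ?_
    · exact filtration_anti (by omega) (mul_mem_filtration (graft_mem_filtration ih1 hL)
        (subst_basisForest_mem_filtration hL ω))
    · exact filtration_anti (by omega) (mul_mem_filtration (graft_mem_filtration hs' h)
        (subst_basisForest_mem_filtration hL ω))
    · exact filtration_anti (by omega) (mul_mem_filtration (graft_mem_filtration hs' hL') ih2)

theorem subst_sub_subst_mem_filtration {L L' : OF K} (hL : L ∈ filtration K 1)
    (hL' : L' ∈ filtration K 1) {k : ℕ} (h : L - L' ∈ filtration K k) (x : OF K) :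
    subst L x - subst L' x ∈ filtration K k := by
  cases k with
  | zero => rw [filtration_zero]; trivial
  | succ k =>
    refine mem_of_forall_basisForest ((filtration K (k + 1)).comap
      ((subst L).toLinearMap - (subst L').toLinearMap)) (fun ω => ?_) x
    change subst L (basisForest K ω) - subst L' (basisForest K ω) ∈ filtration K (k + 1)
    by_cases hω : ω = []
    · simp [hω, basisForest_nil]
    · have : Forest.vertices ω ≠ 0 := fun h => hω (Forest.eq_nil_of_vertices_eq_zero h)
      exact filtration_anti (by omega) (subst_basisForest_sub_mem_filtration hL hL' h ω)

theorem subst_smul_bullet (c : K) (ω : Forest) :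
    subst (c • bullet K) (basisForest K ω) = c ^ Forest.vertices ω • basisForest K ω := by
  induction ω using Forest.node_cons_induction with
  | nil => simp [basisForest_nil, Forest.vertices]
  | node_cons ts ω ih1 ih2 =>
    have h : graft (basisForest K ts) (bullet K) = basisForest K [.node ts] :=
      Bplus_basisForest ts
    rw [subst_basisForest_node_cons, ih1, ih2, vertices_node_cons, basisForest_cons]
    simp only [map_smul, LinearMap.smul_apply, h, smul_mul_smul_comm, smul_smul]
    congr 1
    ring

/-- An endomorphism of `OF` which is the scaling by `c ^ n` in degree `n`, up to terms of higher
degree. -/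
def IsTriangular (c : K) (f : OF K →ₗ[K] OF K) : Prop :=
  ∀ ω, f (basisForest K ω) - c ^ Forest.vertices ω • basisForest K ω ∈
    filtration K (Forest.vertices ω + 1)

theorem isTriangular_subst {L : OF K} (hL : L ∈ filtration K 1) :
    IsTriangular (coeffAt [PTree.leaf] L) (subst L).toLinearMap := by
  intro ω
  rw [AlgHom.toLinearMap_apply, ← subst_smul_bullet]
  have hb : coeffAt [PTree.leaf] L • bullet K ∈ filtration K 1 :=
    Submodule.smul_mem _ _ (basisForest_mem_filtration le_rfl)
  refine subst_basisForest_sub_mem_filtration hL hb ?_ ω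
  refine mem_filtration_iff.2 fun ω hω => ?_
  rcases (show Forest.vertices ω = 0 ∨ Forest.vertices ω = 1 by omega) with h | h
  · exact mem_filtration_iff.1 (sub_mem hL hb) ω (by omega)
  · rw [Forest.eq_leaf_of_vertices_eq_one h]
    simp [bullet, coeffAt_basisForest]

theorem isTriangular_glMul {x : OF K} (hx : coeffAt [] x = 1) : IsTriangular 1 (glMul x) := by
  intro ω
  have h : x - 1 ∈ filtration K 1 := by
    refine mem_filtration_iff.2 fun ω hω => ?_
    rw [Forest.eq_nil_of_vertices_eq_zero (by omega : Forest.vertices ω = 0), ← basisForest_nil]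
    simp [hx, coeffAt_basisForest]
  have e : glMul x (basisForest K ω) - (1 : K) ^ Forest.vertices ω • basisForest K ω =
      glMul (x - 1) (basisForest K ω) := by
    simp [isGraftingRep_glMul.map_one]
  rw [e, add_comm]
  exact glMul_mem_filtration h (basisForest_mem_filtration le_rfl)

theorem IsTriangular.sub_smul_mem {c : K} {f : OF K →ₗ[K] OF K} (hf : IsTriangular c f) {n : ℕ}
    {x : OF K} (hx : x ∈ filtration K n) : f x - c ^ n • x ∈ filtration K (n + 1) := by
  refine apply_mem_of_mem_filtration (f := f - c ^ n • LinearMap.id) (fun ω hω => ?_) hx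
  rw [LinearMap.sub_apply, LinearMap.smul_apply, LinearMap.id_apply]
  rcases hω.eq_or_lt with rfl | h
  · exact hf ω
  · have h' : basisForest K ω ∈ filtration K (n + 1) := basisForest_mem_filtration h
    have := add_mem (filtration_anti (by omega) (hf ω))
      (Submodule.smul_mem _ (c ^ Forest.vertices ω) h')
    rw [sub_add_cancel] at this
    exact sub_mem this (Submodule.smul_mem _ _ h')

/-! ### The filtration of the tensor square -/

/-- The basis of pairs of forests. -/
def tensorBasis (K : Type*) [Field K] : Module.Basis (Forest × Forest) K (OF K ⊗[K] OF K) :=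
  (forestBasis K).tensorProduct (forestBasis K)

theorem tensorBasis_apply (p : Forest × Forest) :
    tensorBasis K p = basisForest K p.1 ⊗ₜ[K] basisForest K p.2 := by
  rw [tensorBasis, Module.Basis.tensorProduct_apply', forestBasis_apply, forestBasis_apply]

/-- The coefficient of a pair of forests, as a linear form. -/
def coeffTensor (u v : Forest) : OF K ⊗[K] OF K →ₗ[K] K := (tensorBasis K).coord (u, v)

@[simp]
theorem coeffTensor_tmul (u v : Forest) (x y : OF K) :
    coeffTensor u v (x ⊗ₜ[K] y) = coeffAt u x * coeffAt v y := by
  rw [coeffTensor, Module.Basis.coord_apply, tensorBasis,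
    Module.Basis.tensorProduct_repr_tmul_apply, forestBasis_repr, forestBasis_repr, smul_eq_mul,
    mul_comm]

/-- The span of the pairs of forests with at least `n` vertices in total. -/
def filtrationTensor (K : Type*) [Field K] (n : ℕ) : Submodule K (OF K ⊗[K] OF K) :=
  Submodule.span K ((fun p : Forest × Forest => basisForest K p.1 ⊗ₜ[K] basisForest K p.2) ''
    {p | n ≤ Forest.vertices p.1 + Forest.vertices p.2})

theorem mem_filtrationTensor_iff {n : ℕ} {z : OF K ⊗[K] OF K} :
    z ∈ filtrationTensor K n ↔
      ∀ u v, Forest.vertices u + Forest.vertices v < n → coeffTensor u v z = 0 := by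
  have h : filtrationTensor K n = Submodule.span K
      (tensorBasis K '' {p | n ≤ Forest.vertices p.1 + Forest.vertices p.2}) := by
    simp only [filtrationTensor, Set.image, tensorBasis_apply]
  rw [h, Module.Basis.mem_span_image]
  refine ⟨fun h u v huv => ?_, fun h p hp => ?_⟩
  · by_contra hne
    exact absurd (h (Finsupp.mem_support_iff.2 hne)) (by simpa using huv)
  · by_contra hne
    exact Finsupp.mem_support_iff.1 hp (h p.1 p.2 (by simpa using hne))

theorem filtrationTensor_zero : filtrationTensor K 0 = ⊤ :=
  eq_top_iff.2 fun _ _ => mem_filtrationTensor_iff.2 fun _ _ h => absurd h (Nat.not_lt_zero _)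

theorem filtrationTensor_anti {m n : ℕ} (h : m ≤ n) :
    filtrationTensor K n ≤ filtrationTensor K m :=
  Submodule.span_mono (Set.image_mono fun _ hp => h.trans hp)

theorem apply_mem_of_mem_filtrationTensor {V : Type*} [AddCommGroup V] [Module K V]
    {f : OF K ⊗[K] OF K →ₗ[K] V} {n : ℕ} {S : Submodule K V}
    (h : ∀ u v, n ≤ Forest.vertices u + Forest.vertices v →
      f (basisForest K u ⊗ₜ[K] basisForest K v) ∈ S)
    {z : OF K ⊗[K] OF K} (hz : z ∈ filtrationTensor K n) : f z ∈ S := by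
  suffices hle : filtrationTensor K n ≤ S.comap f from hle hz
  refine Submodule.span_le.2 ?_
  rintro _ ⟨p, hp, rfl⟩
  exact h p.1 p.2 hp

theorem tmul_mem_filtrationTensor {m n : ℕ} {x y : OF K} (hx : x ∈ filtration K m)
    (hy : y ∈ filtration K n) : x ⊗ₜ[K] y ∈ filtrationTensor K (m + n) := by
  refine LinearMap.BilinMap.apply_apply_mem_of_mem_span _ _ _
    (TensorProduct.mk K (OF K) (OF K)) ?_ x y hx hy
  rintro _ ⟨u, hu, rfl⟩ _ ⟨v, hv, rfl⟩
  exact Submodule.subset_span ⟨(u, v), show m + n ≤ Forest.vertices u + Forest.vertices v from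
    add_le_add hu hv, rfl⟩

theorem outer_glMul_mem_filtrationTensor {m n : ℕ} {z w : OF K ⊗[K] OF K}
    (hz : z ∈ filtrationTensor K m) (hw : w ∈ filtrationTensor K n) :
    outer glMul glMul z w ∈ filtrationTensor K (m + n) := by
  refine LinearMap.BilinMap.apply_apply_mem_of_mem_span _ _ _ (outer glMul glMul) ?_ z w hz hw
  rintro _ ⟨p, hp, rfl⟩ _ ⟨q, hq, rfl⟩
  rw [Set.mem_ofPred_eq] at hp hq
  dsimp only
  rw [outer_tmul_tmul]
  have h (u v : Forest) := glMul_mem_filtration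
    (basisForest_mem_filtration (K := K) (le_refl (Forest.vertices u)))
    (basisForest_mem_filtration (le_refl (Forest.vertices v)))
  exact filtrationTensor_anti (by omega) (tmul_mem_filtrationTensor (h p.1 q.1) (h p.2 q.2))

theorem map_mem_filtrationTensor {f : OF K →ₗ[K] OF K}
    (hf : ∀ ω, f (basisForest K ω) ∈ filtration K (Forest.vertices ω)) {n : ℕ}
    {z : OF K ⊗[K] OF K} (hz : z ∈ filtrationTensor K n) :
    TensorProduct.map f f z ∈ filtrationTensor K n := by
  refine apply_mem_of_mem_filtrationTensor (fun u v huv => ?_) hz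
  rw [TensorProduct.map_tmul]
  exact filtrationTensor_anti huv (tmul_mem_filtrationTensor (hf u) (hf v))

theorem IsTriangular.mem_filtration {c : K} {f : OF K →ₗ[K] OF K} (hf : IsTriangular c f)
    (ω : Forest) : f (basisForest K ω) ∈ filtration K (Forest.vertices ω) := by
  have h := Submodule.add_mem _ (filtration_anti (Nat.le_succ _) (hf ω))
    (Submodule.smul_mem _ (c ^ Forest.vertices ω) (basisForest_mem_filtration (le_refl _)))
  rwa [sub_add_cancel] at h

theorem IsTriangular.map_sub_smul_mem {c : K} {f : OF K →ₗ[K] OF K} (hf : IsTriangular c f) {n : ℕ}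
    {z : OF K ⊗[K] OF K} (hz : z ∈ filtrationTensor K n) :
    TensorProduct.map f f z - c ^ n • z ∈ filtrationTensor K (n + 1) := by
  refine apply_mem_of_mem_filtrationTensor
    (f := TensorProduct.map f f - c ^ n • LinearMap.id) (fun u v huv => ?_) hz
  rw [LinearMap.sub_apply, LinearMap.smul_apply, LinearMap.id_apply, TensorProduct.map_tmul]
  rcases huv.eq_or_lt with rfl | h
  · have e : f (basisForest K u) ⊗ₜ[K] f (basisForest K v) -
        c ^ (Forest.vertices u + Forest.vertices v) • (basisForest K u ⊗ₜ[K] basisForest K v) =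
        (f (basisForest K u) - c ^ Forest.vertices u • basisForest K u) ⊗ₜ[K]
            f (basisForest K v) +
          (c ^ Forest.vertices u • basisForest K u) ⊗ₜ[K]
            (f (basisForest K v) - c ^ Forest.vertices v • basisForest K v) := by
      rw [TensorProduct.sub_tmul, TensorProduct.tmul_sub, TensorProduct.smul_tmul_smul, pow_add]
      abel
    rw [e]
    refine Submodule.add_mem _ ?_ ?_
    · exact filtrationTensor_anti (by omega)
        (tmul_mem_filtrationTensor (hf u) (hf.mem_filtration v))
    · exact filtrationTensor_anti (by omega) (tmul_mem_filtrationTensor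
        (Submodule.smul_mem _ _ (basisForest_mem_filtration (le_refl _))) (hf v))
  · have h' (x y : OF K) (hx : x ∈ filtration K (Forest.vertices u))
        (hy : y ∈ filtration K (Forest.vertices v)) := filtrationTensor_anti h
          (tmul_mem_filtrationTensor hx hy)
    exact Submodule.sub_mem _ (h' _ _ (hf.mem_filtration u) (hf.mem_filtration v))
      (Submodule.smul_mem _ _ (h' _ _ (basisForest_mem_filtration (le_refl _))
        (basisForest_mem_filtration (le_refl _))))

/-- The tensor square of a triangular endomorphism with non-zero diagonal reflects the filtration. -/
theorem IsTriangular.mem_filtrationTensor_of_map_mem {c : K} (hc : c ≠ 0) {f : OF K →ₗ[K] OF K}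
    (hf : IsTriangular c f) {N : ℕ} {z : OF K ⊗[K] OF K}
    (hz : TensorProduct.map f f z ∈ filtrationTensor K N) : z ∈ filtrationTensor K N := by
  suffices h : ∀ n ≤ N, z ∈ filtrationTensor K n from h N le_rfl
  intro n
  induction n with
  | zero => intro _; rw [filtrationTensor_zero]; trivial
  | succ n ih =>
    intro hn
    have h := Submodule.sub_mem _ (filtrationTensor_anti hn hz)
      (hf.map_sub_smul_mem (ih (by omega)))
    rw [sub_sub_cancel] at h
    exact (Submodule.smul_mem_iff _ (pow_ne_zero n hc)).1 h

/-! ### Duality between shuffles and the unshuffle coproduct -/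

theorem coeffAt_nil_tree_mul (τ : PTree) (x : OF K) :
    coeffAt [] (basisForest K [τ] * x) = 0 := by
  suffices h : coeffLin [] ∘ₗ LinearMap.mulLeft K (basisForest K [τ]) = 0 from congr($h x)
  refine linearMap_ext fun ω => ?_
  rw [LinearMap.comp_apply, LinearMap.mulLeft_apply, ← basisForest_cons]
  simp [coeffAt_basisForest]

open Classical in
theorem coeffAt_cons_tree_mul (σ τ : PTree) (ω : Forest) (x : OF K) :
    coeffAt (σ :: ω) (basisForest K [τ] * x) = if τ = σ then coeffAt ω x else 0 := by
  suffices h : coeffLin (σ :: ω) ∘ₗ LinearMap.mulLeft K (basisForest K [τ]) =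
      (if τ = σ then (1 : K) else 0) • coeffLin ω by
    have h' := congr($h x)
    simpa only [LinearMap.comp_apply, LinearMap.mulLeft_apply, LinearMap.smul_apply,
      coeffLin_apply, smul_eq_mul, ite_mul, one_mul, zero_mul] using h'
  refine linearMap_ext fun ω => ?_
  rw [LinearMap.comp_apply, LinearMap.mulLeft_apply, ← basisForest_cons]
  by_cases h : τ = σ <;> simp [coeffAt_basisForest, h]

theorem coeffTensor_nil_tree_mul (τ : PTree) (v : Forest) (z : OF K ⊗[K] OF K) :
    coeffTensor [] v ((basisForest K [τ] ⊗ₜ[K] 1) * z) = 0 := by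
  induction z with
  | zero => simp
  | add a b ha hb => rw [mul_add, map_add, ha, hb, add_zero]
  | tmul a b => simp [coeffAt_nil_tree_mul]

theorem coeffTensor_tree_mul_nil (τ : PTree) (u : Forest) (z : OF K ⊗[K] OF K) :
    coeffTensor u [] ((1 ⊗ₜ[K] basisForest K [τ]) * z) = 0 := by
  induction z with
  | zero => simp
  | add a b ha hb => rw [mul_add, map_add, ha, hb, add_zero]
  | tmul a b => simp [coeffAt_nil_tree_mul]

open Classical in
theorem coeffTensor_cons_tree_mul (σ τ : PTree) (u v : Forest) (z : OF K ⊗[K] OF K) :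
    coeffTensor (σ :: u) v ((basisForest K [τ] ⊗ₜ[K] 1) * z) =
      if τ = σ then coeffTensor u v z else 0 := by
  induction z with
  | zero => simp
  | add a b ha hb => rw [mul_add, map_add, ha, hb, map_add]; split_ifs <;> simp
  | tmul a b => simp [coeffAt_cons_tree_mul]

open Classical in
theorem coeffTensor_tree_mul_cons (σ τ : PTree) (u v : Forest) (z : OF K ⊗[K] OF K) :
    coeffTensor u (σ :: v) ((1 ⊗ₜ[K] basisForest K [τ]) * z) =
      if τ = σ then coeffTensor u v z else 0 := by
  induction z with
  | zero => simp
  | add a b ha hb => rw [mul_add, map_add, ha, hb, map_add]; split_ifs <;> simp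
  | tmul a b => simp [coeffAt_cons_tree_mul]

theorem shuffles_nil_right (u : Forest) : shuffles u [] = [u] := by
  cases u <;> simp [shuffles]

/-- The unshuffle coproduct is dual to the shuffle product. -/
theorem coeffTensor_unshuffle (u v : Forest) (x : OF K) :
    coeffTensor u v (unshuffle K x) = ((shuffles u v).map fun w => coeffAt w x).sum := by
  suffices h : coeffTensor u v ∘ₗ (unshuffle K).toLinearMap =
      ((shuffles u v).map fun w => coeffLin (K := K) w).sum by
    have h' := congr($h x)
    rw [LinearMap.comp_apply, AlgHom.toLinearMap_apply] at h'
    rw [h']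
    clear h h'
    induction shuffles u v with
    | nil => simp
    | cons a l ih => simp [ih]
  refine linearMap_ext fun ω => ?_
  have hs (l : List Forest) : (l.map fun w => coeffLin (K := K) w).sum (basisForest K ω) =
      (l.map fun w => coeffAt w (basisForest K ω)).sum := by
    induction l with
    | nil => simp
    | cons a l ih => simp [ih]
  rw [hs, LinearMap.comp_apply, AlgHom.toLinearMap_apply]
  clear hs
  induction ω generalizing u v with
  | nil =>
    rw [basisForest_nil, map_one, Algebra.TensorProduct.one_def, coeffTensor_tmul,
      ← basisForest_nil]
    cases u <;> cases v <;> simp [shuffles, coeffAt_basisForest, Function.comp_def]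
  | cons τ ω ih =>
    rw [basisForest_cons, map_mul, isPrimitive_tree τ, add_mul, map_add]
    cases u with
    | nil =>
      rw [coeffTensor_nil_tree_mul, zero_add]
      cases v with
      | nil => simp [coeffTensor_tree_mul_nil, shuffles, coeffAt_nil_tree_mul]
      | cons σ v => simp [coeffTensor_tree_mul_cons, coeffAt_cons_tree_mul, shuffles, ih]
    | cons ρ u =>
      cases v with
      | nil =>
        simp [coeffTensor_tree_mul_nil, coeffTensor_cons_tree_mul, coeffAt_cons_tree_mul,
          shuffles_nil_right, ih]
      | cons σ v =>
        rw [coeffTensor_tree_mul_cons, coeffTensor_cons_tree_mul, ih, ih, shuffles,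
          List.map_append, List.sum_append, List.map_map, List.map_map]
        congr 1
        · by_cases h : τ = ρ <;> simp [h, Function.comp_def, coeffAt_cons_tree_mul]
        · by_cases h : τ = σ <;> simp [h, Function.comp_def, coeffAt_cons_tree_mul]

theorem vertices_of_mem_shuffles {u v w : Forest} (h : w ∈ shuffles u v) :
    Forest.vertices w = Forest.vertices u + Forest.vertices v := by
  fun_induction shuffles u v generalizing w with
  | case1 v => simp_all [Forest.vertices]
  | case2 σ u => simp_all [Forest.vertices]
  | case3 σ u τ v ih1 ih2 =>
    simp only [List.mem_append, List.mem_map] at h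
    rcases h with ⟨w, h, rfl⟩ | ⟨w, h, rfl⟩
    · have := ih1 h
      simp only [Forest.vertices] at *; omega
    · have := ih2 h
      simp only [Forest.vertices] at *; omega

theorem length_of_mem_shuffles {u v w : Forest} (h : w ∈ shuffles u v) :
    w.length = u.length + v.length := by
  fun_induction shuffles u v generalizing w with
  | case1 v => simp_all
  | case2 σ u => simp_all
  | case3 σ u τ v ih1 ih2 =>
    simp only [List.mem_append, List.mem_map] at h
    rcases h with ⟨w, h, rfl⟩ | ⟨w, h, rfl⟩
    · have := ih1 h
      simp only [List.length_cons] at *; omega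
    · have := ih2 h
      simp only [List.length_cons] at *; omega

theorem length_shuffles (u v : Forest) :
    (shuffles u v).length = (u.length + v.length).choose u.length := by
  fun_induction shuffles u v with
  | case1 v => simp
  | case2 σ u => simp
  | case3 σ u τ v ih1 ih2 =>
    simp only [List.length_append, List.length_map, ih1, ih2, List.length_cons]
    rw [show u.length + 1 + (v.length + 1) = (u.length + v.length + 1) + 1 by omega,
      Nat.choose_succ_succ]
    congr 2
    omega

theorem shuffle_basisForest (u v : Forest) :
    shuffle (basisForest K u) (basisForest K v) = ((shuffles u v).map (basisForest K)).sum := by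
  simp [shuffle]

/-! ### Linear forms as series of forests -/

/-- `x` is a truncation of the series `∑ β(ω) ω` at order `N`. -/
def IsTruncation (N : ℕ) (β : Module.Dual K (OF K)) (x : OF K) : Prop :=
  ∀ ω, Forest.vertices ω < N → coeffAt ω x = β (basisForest K ω)

theorem exists_isTruncation (N : ℕ) (β : Module.Dual K (OF K)) : ∃ x, IsTruncation N β x := by
  classical
  refine ⟨∑ ω ∈ (Forest.finite_vertices_le N).toFinset, β (basisForest K ω) • basisForest K ω,
    fun ω hω => ?_⟩
  rw [coeffAt_sum, Finset.sum_eq_single ω]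
  · simp [coeffAt_basisForest]
  · intro ω' _ h
    simp [coeffAt_basisForest, h]
  · intro h
    exact absurd ((Forest.finite_vertices_le N).mem_toFinset.2 hω.le) h

theorem dual_ext {β γ : Module.Dual K (OF K)}
    (h : ∀ N, ∃ x, IsTruncation N β x ∧ IsTruncation N γ x) : β = γ := by
  refine linearMap_ext fun ω => ?_
  obtain ⟨x, h1, h2⟩ := h (Forest.vertices ω + 1)
  rw [← h1 ω (Nat.lt_succ_self _), h2 ω (Nat.lt_succ_self _)]

theorem IsTruncation.mem_filtration {N n : ℕ} {β : Module.Dual K (OF K)} {x : OF K}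
    (hx : IsTruncation N β x) (hn : n ≤ N)
    (hβ : ∀ ω, Forest.vertices ω < n → β (basisForest K ω) = 0) : x ∈ filtration K n :=
  mem_filtration_iff.2 fun ω hω => by rw [hx ω (hω.trans_le hn), hβ ω hω]

theorem sum_forestOfSize (n : ℕ) (u : Forest) (g : Forest → K) :
    ∑ ω : ForestOfSize n, coeffAt ω.1 (basisForest K u) * g ω.1 =
      if Forest.vertices u = n then g u else 0 := by
  classical
  split_ifs with h
  · refine (Finset.sum_eq_single (⟨u, h⟩ : ForestOfSize n) (fun ω _ hne => ?_)
      fun hn => ?_).trans ?_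
    · have : u ≠ ω.1 := fun e => hne (Subtype.ext e.symm)
      simp [coeffAt_basisForest, this]
    · exact (hn (Finset.mem_univ (α := ForestOfSize n) _)).elim
    · simp [coeffAt_basisForest]
  · refine Finset.sum_eq_zero fun ω _ => ?_
    have : u ≠ ω.1 := fun e => h (e ▸ ω.2)
    simp [coeffAt_basisForest, this]

theorem coeffAt_glMul (ω : Forest) (x y : OF K) :
    coeffAt ω (glMul x y) =
      ∑ p ∈ Finset.HasAntidiagonal.antidiagonal (Forest.vertices ω),
        ∑ ω₁ : ForestOfSize p.1, ∑ ω₂ : ForestOfSize p.2,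
          coeffAt ω₁.1 x * (coeffAt ω₂.1 y *
            coeffAt ω (glMul (basisForest K ω₁.1) (basisForest K ω₂.1))) := by
  suffices h : glMul.compr₂ (coeffLin ω) =
      ∑ p ∈ Finset.HasAntidiagonal.antidiagonal (Forest.vertices ω),
        ∑ ω₁ : ForestOfSize p.1, ∑ ω₂ : ForestOfSize p.2,
          coeffAt ω (glMul (basisForest K ω₁.1) (basisForest K ω₂.1)) •
            (LinearMap.mul K K).compl₁₂ (coeffLin (K := K) ω₁.1) (coeffLin ω₂.1) by
    have h' := congr($h x y)
    simp only [LinearMap.compr₂_apply, coeffLin_apply, LinearMap.sum_apply, LinearMap.smul_apply,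
      LinearMap.compl₁₂_apply, LinearMap.mul_apply', smul_eq_mul] at h'
    rw [h']
    refine Finset.sum_congr rfl fun p _ => Finset.sum_congr rfl fun ω₁ _ =>
      Finset.sum_congr rfl fun ω₂ _ => ?_
    ring
  refine linearMap_ext fun u => linearMap_ext fun v => ?_
  simp only [LinearMap.compr₂_apply, coeffLin_apply, LinearMap.sum_apply, LinearMap.smul_apply,
    LinearMap.compl₁₂_apply, LinearMap.mul_apply', smul_eq_mul]
  have e (p : ℕ × ℕ) : ∑ ω₁ : ForestOfSize p.1, ∑ ω₂ : ForestOfSize p.2,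
      coeffAt ω (glMul (basisForest K ω₁.1) (basisForest K ω₂.1)) *
        (coeffAt ω₁.1 (basisForest K u) * coeffAt ω₂.1 (basisForest K v)) =
      if Forest.vertices u = p.1 then (if Forest.vertices v = p.2 then
        coeffAt ω (glMul (basisForest K u) (basisForest K v)) else 0) else 0 := by
    rw [← sum_forestOfSize p.1 u fun u => if Forest.vertices v = p.2 then
        coeffAt ω (glMul (basisForest K u) (basisForest K v)) else 0]
    refine Finset.sum_congr rfl fun ω₁ _ => ?_
    rw [← sum_forestOfSize p.2 v fun v => coeffAt ω (glMul (basisForest K ω₁.1) (basisForest K v)),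
      Finset.mul_sum]
    refine Finset.sum_congr rfl fun ω₂ _ => ?_
    ring
  simp only [e]
  by_cases h : Forest.vertices u + Forest.vertices v = Forest.vertices ω
  · rw [Finset.sum_eq_single (Forest.vertices u, Forest.vertices v)]
    · simp
    · rintro ⟨p, q⟩ _ hne
      split_ifs with h1 h2
      · exact absurd (Prod.ext h1.symm h2.symm) hne
      · rfl
      · rfl
    · intro hn
      exact absurd (Finset.HasAntidiagonal.mem_antidiagonal.2 h) hn
  · rw [coeffAt_eq_zero_of_mem_homogeneous
      (glMul_mem_homogeneous u (basisForest_mem_homogeneous v)) (Ne.symm h)]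
    simp

theorem convN_basisForest (β γ : Module.Dual K (OF K)) (ω : Forest) :
    convN β γ (basisForest K ω) =
      ∑ p ∈ Finset.HasAntidiagonal.antidiagonal (Forest.vertices ω),
        ∑ ω₁ : ForestOfSize p.1, ∑ ω₂ : ForestOfSize p.2,
          β (basisForest K ω₁.1) * (γ (basisForest K ω₂.1) *
            coeffAt ω (glMul (basisForest K ω₁.1) (basisForest K ω₂.1))) := by
  simp only [convN, deltaN, LinearMap.comp_apply, linExt_basisForest, map_sum, map_smul,
    TensorProduct.map_tmul, LinearMap.mul'_apply, smul_eq_mul, glMul_apply]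
  refine Finset.sum_congr rfl fun p _ => Finset.sum_congr rfl fun ω₁ _ =>
    Finset.sum_congr rfl fun ω₂ _ => ?_
  ring

/-- The convolution product is the Grossman--Larson product of series. -/
theorem IsTruncation.convN {N : ℕ} {β γ : Module.Dual K (OF K)} {x y : OF K}
    (hx : IsTruncation N β x) (hy : IsTruncation N γ y) :
    IsTruncation N (convN β γ) (glMul x y) := by
  intro ω hω
  rw [convN_basisForest, coeffAt_glMul]
  refine Finset.sum_congr rfl fun p hp => Finset.sum_congr rfl fun ω₁ _ =>
    Finset.sum_congr rfl fun ω₂ _ => ?_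
  have hp' := Finset.HasAntidiagonal.mem_antidiagonal.1 hp
  rw [hx ω₁.1 (by rw [ω₁.2]; omega), hy ω₂.1 (by rw [ω₂.2]; omega)]

/-! ### Exponential linear maps as group-like series -/

theorem coeffTensor_unshuffle_eq {N : ℕ} {β : Module.Dual K (OF K)} {x : OF K}
    (hx : IsTruncation N β x) {u v : Forest} (h : Forest.vertices u + Forest.vertices v < N) :
    coeffTensor u v (unshuffle K x) = β (shuffle (basisForest K u) (basisForest K v)) := by
  rw [coeffTensor_unshuffle, shuffle_basisForest, map_list_sum, List.map_map]
  congr 1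
  refine List.map_congr_left fun w hw => ?_
  exact hx w (by rwa [vertices_of_mem_shuffles hw])

theorem IsExponential.unshuffle_sub_mem {β : Module.Dual K (OF K)} (hβ : IsExponential β) {N : ℕ}
    {x : OF K} (hx : IsTruncation N β x) :
    unshuffle K x - x ⊗ₜ[K] x ∈ filtrationTensor K N := by
  refine mem_filtrationTensor_iff.2 fun u v h => ?_
  rw [map_sub, coeffTensor_unshuffle_eq hx h, coeffTensor_tmul, hβ.2, hx u (by omega),
    hx v (by omega), sub_self]

theorem isExponential_of_unshuffle_sub_mem {β : Module.Dual K (OF K)} (h1 : β (basisForest K []) = 1)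
    (h : ∀ N, ∃ x, IsTruncation N β x ∧ unshuffle K x - x ⊗ₜ[K] x ∈ filtrationTensor K N) :
    IsExponential β := by
  refine ⟨h1, fun x y => ?_⟩
  suffices e : shuffle.compr₂ β = (LinearMap.mul K K).compl₁₂ β β from congr($e x y)
  refine linearMap_ext fun u => linearMap_ext fun v => ?_
  obtain ⟨x, hx, hd⟩ := h (Forest.vertices u + Forest.vertices v + 1)
  have hd := mem_filtrationTensor_iff.1 hd u v (Nat.lt_succ_self _)
  rw [map_sub, sub_eq_zero, coeffTensor_unshuffle_eq hx (Nat.lt_succ_self _), coeffTensor_tmul,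
    hx u (by omega), hx v (by omega)] at hd
  exact hd

theorem coeffAt_nil_glMul (x y : OF K) :
    coeffAt [] (glMul x y) = coeffAt [] x * coeffAt [] y := by
  classical
  suffices h : glMul.compr₂ (coeffLin []) =
      (LinearMap.mul K K).compl₁₂ (coeffLin (K := K) []) (coeffLin []) from congr($h x y)
  refine linearMap_ext fun u => linearMap_ext fun v => ?_
  simp only [LinearMap.compr₂_apply, coeffLin_apply, LinearMap.compl₁₂_apply, LinearMap.mul_apply']
  by_cases h : Forest.vertices u + Forest.vertices v = 0
  · rw [Forest.eq_nil_of_vertices_eq_zero (by omega : Forest.vertices u = 0),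
      Forest.eq_nil_of_vertices_eq_zero (by omega : Forest.vertices v = 0), basisForest_nil,
      glMul_one_right, ← basisForest_nil]
    simp [coeffAt_basisForest]
  · rw [coeffAt_eq_zero_of_mem_homogeneous
      (glMul_mem_homogeneous u (basisForest_mem_homogeneous v))
      (by simpa [Forest.vertices] using Ne.symm h)]
    rw [coeffAt_basisForest, coeffAt_basisForest]
    by_cases hu : u = []
    · by_cases hv : v = []
      · subst hu hv; exact absurd rfl h
      · simp [hv]
    · simp [hu]

theorem convN_nil (β γ : Module.Dual K (OF K)) :
    convN β γ (basisForest K []) = β (basisForest K []) * γ (basisForest K []) := by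
  obtain ⟨x, hx⟩ := exists_isTruncation 1 β
  obtain ⟨y, hy⟩ := exists_isTruncation 1 γ
  have h0 : Forest.vertices [] < 1 := Nat.lt_succ_self 0
  rw [← hx.convN hy [] h0, coeffAt_nil_glMul, hx [] h0, hy [] h0]

theorem convN_assoc (β γ δ : Module.Dual K (OF K)) :
    convN (convN β γ) δ = convN β (convN γ δ) := by
  refine dual_ext fun N => ?_
  obtain ⟨x, hx⟩ := exists_isTruncation N β
  obtain ⟨y, hy⟩ := exists_isTruncation N γ
  obtain ⟨z, hz⟩ := exists_isTruncation N δ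
  refine ⟨_, (hx.convN hy).convN hz, ?_⟩
  rw [isGraftingRep_glMul.map_glMul]
  exact hx.convN (hy.convN hz)

theorem IsExponential.convN {β γ : Module.Dual K (OF K)} (hβ : IsExponential β)
    (hγ : IsExponential γ) : IsExponential (convN β γ) := by
  refine isExponential_of_unshuffle_sub_mem (by rw [convN_nil, hβ.1, hγ.1, one_mul]) fun N => ?_
  obtain ⟨x, hx⟩ := exists_isTruncation N β
  obtain ⟨y, hy⟩ := exists_isTruncation N γ
  refine ⟨_, hx.convN hy, ?_⟩
  have e : unshuffle K (glMul x y) - glMul x y ⊗ₜ[K] glMul x y =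
      outer glMul glMul (unshuffle K x - x ⊗ₜ[K] x) (unshuffle K y) +
        outer glMul glMul (x ⊗ₜ[K] x) (unshuffle K y - y ⊗ₜ[K] y) := by
    rw [unshuffle_glMul, map_sub, map_sub, LinearMap.sub_apply, outer_tmul_tmul]
    abel
  have hy0 : unshuffle K y ∈ filtrationTensor K 0 := by rw [filtrationTensor_zero]; trivial
  have hx0 : x ⊗ₜ[K] x ∈ filtrationTensor K 0 := by rw [filtrationTensor_zero]; trivial
  rw [e]
  refine Submodule.add_mem _ ?_ ?_
  · exact outer_glMul_mem_filtrationTensor (n := 0) (hβ.unshuffle_sub_mem hx) hy0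
  · have h := outer_glMul_mem_filtrationTensor hx0 (hγ.unshuffle_sub_mem hy)
    rwa [zero_add] at h

/-- The counit, which is the unit of the convolution product. -/
def counit (K : Type*) [Field K] : Module.Dual K (OF K) := coeffLin []

theorem isTruncation_counit (N : ℕ) : IsTruncation N (counit K) 1 := by
  classical
  intro ω _
  rw [counit, coeffLin_apply, ← basisForest_nil]
  simp [coeffAt_basisForest, eq_comm]

theorem isExponential_counit : IsExponential (counit K) := by
  classical
  refine isExponential_of_unshuffle_sub_mem ?_ fun N => ⟨1, isTruncation_counit N, ?_⟩
  · simp [counit, coeffAt_basisForest]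
  · rw [map_one, Algebra.TensorProduct.one_def, sub_self]
    exact Submodule.zero_mem _

theorem convN_counit (β : Module.Dual K (OF K)) : convN β (counit K) = β := by
  refine dual_ext fun N => ?_
  obtain ⟨x, hx⟩ := exists_isTruncation N β
  have h := hx.convN (isTruncation_counit N)
  rw [glMul_one_right] at h
  exact ⟨x, h, hx⟩

/-! ### Triangular operators on series -/

/-- An operator on series which is the scaling by `c n ≠ 0` in degree `n`, up to terms of higher
degree, is bijective: it is inverted degree by degree. -/
theorem bijective_of_triangular (T : Module.Dual K (OF K) →ₗ[K] Module.Dual K (OF K)) {c : ℕ → K}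
    (hc : ∀ n, c n ≠ 0)
    (hT : ∀ n β, (∀ ω, Forest.vertices ω < n → β (basisForest K ω) = 0) →
      ∀ ω, Forest.vertices ω = n → T β (basisForest K ω) = c n * β (basisForest K ω)) :
    Function.Bijective T := by
  constructor
  · rw [injective_iff_map_eq_zero]
    intro β hβ
    suffices h : ∀ n ω, Forest.vertices ω < n → β (basisForest K ω) = 0 from
      linearMap_ext fun ω => h _ ω (Nat.lt_succ_self _)
    intro n
    induction n with
    | zero => intro ω h; exact absurd h (Nat.not_lt_zero _)
    | succ n ih =>
      intro ω h
      rcases Nat.lt_succ_iff_lt_or_eq.1 h with h | h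
      · exact ih ω h
      · have := hT n β ih ω h
        rw [hβ, LinearMap.zero_apply, eq_comm, mul_eq_zero] at this
        exact this.resolve_left (hc n)
  · intro γ
    -- `s n` solves the equation in degrees less than `n`
    let s : ℕ → Module.Dual K (OF K) := fun n => Nat.rec 0 (fun n β => β + linExt fun ω =>
      if Forest.vertices ω = n then
        (c n)⁻¹ * (γ (basisForest K ω) - T β (basisForest K ω)) else 0) n
    have hs (n : ℕ) (ω : Forest) : s (n + 1) (basisForest K ω) = s n (basisForest K ω) +
        if Forest.vertices ω = n then
          (c n)⁻¹ * (γ (basisForest K ω) - T (s n) (basisForest K ω)) else 0 := by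
      simp [s]
    have hstable (m n : ℕ) (ω : Forest) (hn : Forest.vertices ω < n) :
        s (n + m) (basisForest K ω) = s n (basisForest K ω) := by
      induction m with
      | zero => rfl
      | succ m ih => rw [← add_assoc, hs, ih, if_neg (by omega), add_zero]
    have hdiff (δ ε : Module.Dual K (OF K)) (n : ℕ)
        (h : ∀ ω, Forest.vertices ω < n → δ (basisForest K ω) = ε (basisForest K ω))
        (ω : Forest) (hω : Forest.vertices ω = n) : T δ (basisForest K ω) =
          T ε (basisForest K ω) + c n * (δ (basisForest K ω) - ε (basisForest K ω)) := by
      have := hT n (δ - ε) (fun ω h' => by rw [LinearMap.sub_apply, h ω h', sub_self]) ω hω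
      rw [map_sub, LinearMap.sub_apply, LinearMap.sub_apply] at this
      rw [← this]; ring
    refine ⟨linExt fun ω => s (Forest.vertices ω + 1) (basisForest K ω), linearMap_ext fun ω => ?_⟩
    rw [hdiff _ (s (Forest.vertices ω)) (Forest.vertices ω) (fun ω' h => ?_) ω rfl,
      linExt_basisForest, hs, if_pos rfl, add_sub_cancel_left, mul_inv_cancel_left₀ (hc _)]
    · ring
    · obtain ⟨m, hm⟩ := Nat.exists_eq_add_of_le h
      rw [linExt_basisForest, hm, hstable _ _ _ (Nat.lt_succ_self _)]

/-- Operators on series that are triangular on truncations. -/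
theorem bijective_of_isTriangular (T : Module.Dual K (OF K) →ₗ[K] Module.Dual K (OF K)) {c : K}
    (hc : c ≠ 0)
    (hT : ∀ N β, ∃ f x, IsTriangular c f ∧ IsTruncation N β x ∧ IsTruncation N (T β) (f x)) :
    Function.Bijective T := by
  refine bijective_of_triangular T (c := fun n => c ^ n) (fun n => pow_ne_zero n hc) ?_
  rintro n β hβ ω hω
  obtain ⟨f, x, hf, hx, hfx⟩ := hT (n + 1) β
  have hω' : Forest.vertices ω < n + 1 := by omega
  have h := mem_filtration_iff.1 (hf.sub_smul_mem (hx.mem_filtration (Nat.le_succ n) hβ)) ω hω'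
  rw [coeffAt_sub, coeffAt_smul, hfx ω hω', hx ω hω', sub_eq_zero] at h
  exact h

/-- A series is group-like if its image under a triangular coalgebra morphism is. -/
theorem isExponential_of_triangular {β γ : Module.Dual K (OF K)} (hγ : IsExponential γ)
    (h1 : β (basisForest K []) = 1) {c : K} (hc : c ≠ 0)
    (h : ∀ N, ∃ f x, IsTriangular c f ∧ IsTruncation N β x ∧ IsTruncation N γ (f x) ∧
      unshuffle K (f x) - TensorProduct.map f f (unshuffle K x) ∈ filtrationTensor K N) :
    IsExponential β := by
  refine isExponential_of_unshuffle_sub_mem h1 fun N => ?_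
  obtain ⟨f, x, hf, hx, hfx, hd⟩ := h N
  refine ⟨x, hx, hf.mem_filtrationTensor_of_map_mem hc ?_⟩
  have := Submodule.sub_mem _ (hγ.unshuffle_sub_mem hfx) hd
  rw [map_sub, TensorProduct.map_tmul]
  convert this using 1
  abel

/-- The convolution product by a given linear form, as a linear map. -/
def convLeft (β : Module.Dual K (OF K)) : Module.Dual K (OF K) →ₗ[K] Module.Dual K (OF K) where
  toFun γ := convN β γ
  map_add' γ δ := by
    simp only [convN, TensorProduct.map_add_right, LinearMap.add_comp, LinearMap.comp_add]
  map_smul' c γ := by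
    simp only [convN, TensorProduct.map_smul_right, LinearMap.smul_comp, LinearMap.comp_smul,
      RingHom.id_apply]

/-- Left convolution by an exponential map is unipotent, which provides right inverses; they are again
exponential. -/
theorem exists_convN_eq_counit {β : Module.Dual K (OF K)} (hβ : IsExponential β) :
    ∃ γ, IsExponential γ ∧ convN β γ = counit K := by
  have htri {N : ℕ} {x : OF K} (hx : IsTruncation (N + 1) β x) : IsTriangular 1 (glMul x) :=
    isTriangular_glMul ((hx [] (by simp [Forest.vertices])).trans hβ.1)
  have weaken {N : ℕ} {δ : Module.Dual K (OF K)} {x : OF K} (hx : IsTruncation (N + 1) δ x) :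
      IsTruncation N δ x := fun ω hω => hx ω (by omega)
  have hbij : Function.Bijective (convLeft β) := by
    refine bijective_of_isTriangular _ one_ne_zero fun N γ => ?_
    obtain ⟨x, hx⟩ := exists_isTruncation (N + 1) β
    obtain ⟨y, hy⟩ := exists_isTruncation N γ
    exact ⟨glMul x, y, htri hx, hy, (weaken hx).convN hy⟩
  obtain ⟨γ, hγ⟩ := hbij.2 (counit K)
  have hγ : convN β γ = counit K := hγ
  refine ⟨γ, ?_, hγ⟩
  have h1 : γ (basisForest K []) = 1 := by
    have := convN_nil β γ
    rwa [hγ, isExponential_counit.1, hβ.1, one_mul, eq_comm] at this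
  refine isExponential_of_triangular isExponential_counit h1 one_ne_zero fun N => ?_
  obtain ⟨x, hx⟩ := exists_isTruncation (N + 1) β
  obtain ⟨y, hy⟩ := exists_isTruncation N γ
  refine ⟨glMul x, y, htri hx, hy, hγ ▸ (weaken hx).convN hy, ?_⟩
  have e : TensorProduct.map (glMul x) (glMul x) = outer glMul glMul (x ⊗ₜ[K] x) :=
    TensorProduct.ext' fun a b => by simp
  have hy0 : unshuffle K y ∈ filtrationTensor K 0 := by rw [filtrationTensor_zero]; trivial
  have e' : outer glMul glMul (unshuffle K x) (unshuffle K y) -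
      outer glMul glMul (x ⊗ₜ[K] x) (unshuffle K y) =
        outer glMul glMul (unshuffle K x - x ⊗ₜ[K] x) (unshuffle K y) := by
    rw [map_sub, LinearMap.sub_apply]
  rw [e, unshuffle_glMul, e']
  exact outer_glMul_mem_filtrationTensor (n := 0) (hβ.unshuffle_sub_mem (weaken hx)) hy0

/-! ### The action of the coaction on series -/

theorem coeffAt_eq_zero_of_mem_LiePTDeg {d : ℕ} (z : LiePTDeg K d) {ω : Forest}
    (h : Forest.vertices ω ≠ d) : coeffAt ω ((z : LiePT K) : OF K) = 0 :=
  coeffAt_eq_zero_of_mem_homogeneous z.2 h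

section Star

variable {κ : ℕ → Type*} [∀ d, Fintype (κ d)] (b : ∀ d, Module.Basis (κ d) K (LiePTDeg K d))
  (α : Module.Dual K (LiePT K))

/-- The truncation, at degree `N`, of the series of Lie polynomials `∑ α(e) e` over the basis elements
`e`. -/
def lieSeries (N : ℕ) : LiePT K :=
  ∑ j : (Σ d : Fin (N + 1), κ d), α (b j.1 j.2 : LiePT K) • (b j.1 j.2 : LiePT K)

theorem coeffAt_subst {L : OF K} (hL : L ∈ filtration K 1) (ω : Forest) (x : OF K) :
    coeffAt ω (subst L x) =
      ∑ n ∈ Finset.range (Forest.vertices ω + 1), ∑ ω' : ForestOfSize n,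
        coeffAt ω'.1 x * coeffAt ω (subst L (basisForest K ω'.1)) := by
  suffices h : coeffLin ω ∘ₗ (subst L).toLinearMap =
      ∑ n ∈ Finset.range (Forest.vertices ω + 1), ∑ ω' : ForestOfSize n,
        coeffAt ω (subst L (basisForest K ω'.1)) • coeffLin (K := K) ω'.1 by
    have h' := congr($h x)
    simp only [LinearMap.comp_apply, coeffLin_apply, AlgHom.toLinearMap_apply, LinearMap.sum_apply,
      LinearMap.smul_apply, smul_eq_mul] at h'
    rw [h']
    exact Finset.sum_congr rfl fun n _ => Finset.sum_congr rfl fun ω' _ => mul_comm _ _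
  refine linearMap_ext fun u => ?_
  simp only [LinearMap.comp_apply, coeffLin_apply, AlgHom.toLinearMap_apply, LinearMap.sum_apply,
    LinearMap.smul_apply, smul_eq_mul]
  have e (n : ℕ) : ∑ ω' : ForestOfSize n, coeffAt ω (subst L (basisForest K ω'.1)) *
      coeffAt ω'.1 (basisForest K u) =
        if Forest.vertices u = n then coeffAt ω (subst L (basisForest K u)) else 0 := by
    rw [← sum_forestOfSize n u fun u => coeffAt ω (subst L (basisForest K u))]
    exact Finset.sum_congr rfl fun ω' _ => mul_comm _ _
  simp only [e, Finset.sum_ite_eq, Finset.mem_range]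
  split_ifs with h
  · rfl
  · exact mem_filtration_iff.1 (subst_basisForest_mem_filtration hL u) ω (by omega)

/-- The form `α̂ ⋆ β` is obtained from the series of `β` by substituting for the vertex the series of
Lie polynomials of `α`. -/
theorem star_basisForest [CharZero K] (β : Module.Dual K (OF K)) (ω : Forest) :
    star b (character α) β (basisForest K ω) =
      ∑ n ∈ Finset.range (Forest.vertices ω + 1), ∑ ω' : ForestOfSize n,
        β (basisForest K ω'.1) *
          coeffAt ω (subst (lieSeries b α (Forest.vertices ω) : OF K) (basisForest K ω'.1)) := by
  simp only [star, coaction, LinearMap.comp_apply, linExt_basisForest, map_sum, map_smul,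
    TensorProduct.map_tmul, LinearMap.mul'_apply, smul_eq_mul]
  refine Finset.sum_congr rfl fun n _ => Finset.sum_congr rfl fun ω' _ => ?_
  have hchar (c : Fin n → (Σ d : Fin (Forest.vertices ω + 1), κ d)) :
      character α (∏ i, SymmetricAlgebra.ι K (LiePT K) (b (c i).1 (c i).2 : LiePT K)) =
        ∏ i, α (b (c i).1 (c i).2 : LiePT K) := by
    simp only [character, AlgHom.toLinearMap_apply, map_prod, SymmetricAlgebra.lift_ι_apply]
  have h := congr(coeffAt ω $(sum_compose
    (fun j : (Σ d : Fin (Forest.vertices ω + 1), κ d) => α (b j.1 j.2 : LiePT K))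
    (fun j => (b j.1 j.2 : LiePT K)) ω'))
  simp only [coeffAt_sum, coeffAt_smul] at h
  have hn : (n.factorial : K) ≠ 0 := Nat.cast_ne_zero.2 n.factorial_ne_zero
  change _ = _ * coeffAt ω (subst ((∑ j : (Σ d : Fin (Forest.vertices ω + 1), κ d),
    α (b j.1 j.2 : LiePT K) • (b j.1 j.2 : LiePT K) : LiePT K) : OF K) (basisForest K ω'.1))
  rw [← inv_mul_eq_iff_eq_mul₀ hn] at h
  rw [← h, Finset.mul_sum, Finset.mul_sum]
  refine Finset.sum_congr rfl fun σ _ => ?_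
  rw [Finset.mul_sum, Finset.mul_sum]
  refine Finset.sum_congr rfl fun c _ => ?_
  rw [hchar]
  ring

theorem lieSeries_mem_filtration (N : ℕ) : (lieSeries b α N : OF K) ∈ filtration K 1 :=
  mem_filtration_one_of_mem_LiePT (lieSeries b α N).2

theorem coe_lieSeries (N : ℕ) : (lieSeries b α N : OF K) =
    ∑ d ∈ Finset.range (N + 1), ∑ i : κ d, α (b d i : LiePT K) • ((b d i : LiePT K) : OF K) := by
  rw [Finset.sum_range, lieSeries, Fintype.sum_sigma]
  simp

theorem coeffAt_lieSeries {N d : ℕ} (h : d ≤ N) {ω : Forest} (hω : Forest.vertices ω = d) :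
    coeffAt ω (lieSeries b α N : OF K) =
      ∑ i : κ d, α (b d i : LiePT K) * coeffAt ω ((b d i : LiePT K) : OF K) := by
  rw [coe_lieSeries, coeffAt_sum, Finset.sum_eq_single d]
  · simp only [coeffAt_sum, coeffAt_smul]
  · intro e _ he
    rw [coeffAt_sum]
    refine Finset.sum_eq_zero fun i _ => ?_
    rw [coeffAt_smul, coeffAt_eq_zero_of_mem_LiePTDeg (b e i) (hω.trans_ne he.symm), mul_zero]
  · intro hn
    exact absurd (Finset.mem_range.2 (Nat.lt_succ_of_le h)) hn

theorem lieSeries_sub_mem_filtration {M N : ℕ} (h : M ≤ N) :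
    (lieSeries b α N : OF K) - lieSeries b α M ∈ filtration K (M + 1) :=
  mem_filtration_iff.2 fun ω hω => by
    rw [coeffAt_sub, coeffAt_lieSeries b α (by omega) rfl, coeffAt_lieSeries b α (by omega) rfl,
      sub_self]

variable {b α} in
/-- `α̂ ⋆ β` is, as a series, the image of `β` under the substitution of the series of `α`. -/
theorem IsTruncation.star [CharZero K] {M N : ℕ} (h : N ≤ M + 1) {β : Module.Dual K (OF K)}
    {x : OF K} (hx : IsTruncation N β x) :
    IsTruncation N (star b (character α) β) (subst (lieSeries b α M : OF K) x) := by
  intro ω hω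
  rw [star_basisForest, coeffAt_subst (lieSeries_mem_filtration b α M)]
  refine Finset.sum_congr rfl fun n hn => Finset.sum_congr rfl fun ω' _ => ?_
  rw [hx ω'.1 (by rw [ω'.2]; have := Finset.mem_range.1 hn; omega)]
  congr 1
  have := mem_filtration_iff.1 (subst_sub_subst_mem_filtration (lieSeries_mem_filtration b α M)
    (lieSeries_mem_filtration b α _) (lieSeries_sub_mem_filtration b α
      (show Forest.vertices ω ≤ M by omega)) (basisForest K ω'.1)) ω (Nat.lt_succ_self _)
  rw [coeffAt_sub, sub_eq_zero] at this
  exact this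

/-- The coefficient of the single vertex in the series of `α` is `α(•)`, up to a non-zero square: the
Lie polynomials of degree one are the multiples of `•`. -/
theorem exists_coeffAt_leaf_lieSeries : ∃ r : K, r ≠ 0 ∧ ∀ M, 1 ≤ M →
    coeffAt [PTree.leaf] (lieSeries b α M : OF K) = r * α (lieBullet K) := by
  classical
  have hleaf : Forest.vertices [PTree.leaf] = 1 := by
    simp [Forest.vertices, PTree.vertices, PTree.leaf]
  let e : LiePTDeg K 1 :=
    ⟨lieBullet K, by
      have := basisForest_mem_homogeneous (K := K) [PTree.leaf]
      rwa [hleaf] at this⟩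
  have he : coeffAt [PTree.leaf] (lieBullet K : OF K) = 1 := by
    simp [lieBullet, bullet, coeffAt_basisForest]
  have hz (z : LiePTDeg K 1) : coeffAt [PTree.leaf] ((z : LiePT K) : OF K) • e = z := by
    refine Subtype.ext (Subtype.ext ((forestBasis K).ext_elem fun ω => ?_))
    change coeffAt ω (coeffAt [PTree.leaf] ((z : LiePT K) : OF K) • (lieBullet K : OF K)) =
      coeffAt ω ((z : LiePT K) : OF K)
    rw [coeffAt_smul]
    by_cases hω : Forest.vertices ω = 1
    · rw [Forest.eq_leaf_of_vertices_eq_one hω, he, mul_one]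
    · rw [coeffAt_eq_zero_of_mem_LiePTDeg z hω,
        show coeffAt ω (lieBullet K : OF K) = 0 from coeffAt_eq_zero_of_mem_LiePTDeg e hω,
        mul_zero]
  have he0 : e ≠ 0 := by
    intro h
    have h' : (lieBullet K : OF K) = 0 := congr(((($h : LiePTDeg K 1) : LiePT K) : OF K))
    rw [h', coeffAt_zero] at he
    exact zero_ne_one he
  have hcard := finrank_eq_one e he0 fun z => ⟨_, hz z⟩
  rw [Module.finrank_eq_card_basis (b 1), Fintype.card_eq_one_iff] at hcard
  obtain ⟨i, hi⟩ := hcard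
  set s := coeffAt [PTree.leaf] ((b 1 i : LiePT K) : OF K) with hs
  have hb : (b 1 i : LiePT K) = s • lieBullet K := congr(($(hz (b 1 i)) : LiePT K)).symm
  have hs0 : s ≠ 0 := by
    intro h0
    have h1 := hz (b 1 i)
    rw [← hs, h0, zero_smul] at h1
    exact (b 1).ne_zero i h1.symm
  refine ⟨s * s, mul_ne_zero hs0 hs0, fun M hM => ?_⟩
  rw [coeffAt_lieSeries b α hM hleaf, Finset.sum_eq_single i (fun j _ hj => absurd (hi j) hj)
    (fun h => absurd (Finset.mem_univ _) h), ← hs, hb, map_smul, smul_eq_mul]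
  ring

theorem coeffAt_nil_subst {L : OF K} (hL : L ∈ filtration K 1) (x : OF K) :
    coeffAt [] (subst L x) = coeffAt [] x := by
  have hx : x ∈ filtration K 0 := by rw [filtration_zero]; trivial
  have := mem_filtration_iff.1 ((isTriangular_subst hL).sub_smul_mem hx) [] Nat.one_pos
  rwa [pow_zero, one_smul, coeffAt_sub, sub_eq_zero] at this

variable [CharZero K]

theorem star_nil (β : Module.Dual K (OF K)) :
    star b (character α) β (basisForest K []) = β (basisForest K []) := by
  obtain ⟨x, hx⟩ := exists_isTruncation 1 β
  rw [← hx.star (b := b) (α := α) (M := 1) one_le_two [] Nat.one_pos,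
    coeffAt_nil_subst (lieSeries_mem_filtration b α 1), hx [] Nat.one_pos]

theorem star_convN (β γ : Module.Dual K (OF K)) :
    star b (character α) (convN β γ) =
      convN (star b (character α) β) (star b (character α) γ) := by
  refine dual_ext fun N => ?_
  obtain ⟨x, hx⟩ := exists_isTruncation N β
  obtain ⟨y, hy⟩ := exists_isTruncation N γ
  refine ⟨_, (hx.convN hy).star (M := N) (Nat.le_succ N), ?_⟩
  rw [subst_glMul (lieSeries b α N).2]
  exact (hx.star (Nat.le_succ N)).convN (hy.star (Nat.le_succ N))

variable {α} in
theorem IsExponential.star {β : Module.Dual K (OF K)} (hβ : IsExponential β) :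
    IsExponential (star b (character α) β) := by
  refine isExponential_of_unshuffle_sub_mem ((star_nil b α β).trans hβ.1) fun N => ?_
  obtain ⟨x, hx⟩ := exists_isTruncation N β
  refine ⟨_, hx.star (M := N) (Nat.le_succ N), ?_⟩
  have h := map_mem_filtrationTensor (f := (subst (lieSeries b α N : OF K)).toLinearMap)
    (subst_basisForest_mem_filtration (lieSeries_mem_filtration b α N)) (hβ.unshuffle_sub_mem hx)
  rwa [map_sub, TensorProduct.map_tmul, ← unshuffle_subst (lieSeries b α N).2] at h

/-- The operator `β ↦ α̂ ⋆ β` on linear forms. -/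
def starLin : Module.Dual K (OF K) →ₗ[K] Module.Dual K (OF K) where
  toFun β := LieButcher.star b (character α) β
  map_add' β γ := by
    simp only [LieButcher.star, TensorProduct.map_add_right, LinearMap.add_comp, LinearMap.comp_add]
  map_smul' c β := by
    simp only [LieButcher.star, TensorProduct.map_smul_right, LinearMap.smul_comp,
      LinearMap.comp_smul, RingHom.id_apply]

theorem exists_isTriangular_star {r : K} (hr : ∀ M, 1 ≤ M →
      coeffAt [PTree.leaf] (lieSeries b α M : OF K) = r) (N : ℕ) (β : Module.Dual K (OF K)) :
    ∃ f x, IsTriangular r f ∧ IsTruncation N β x ∧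
      IsTruncation N (LieButcher.star b (character α) β) (f x) ∧
      unshuffle K (f x) - TensorProduct.map f f (unshuffle K x) ∈ filtrationTensor K N := by
  obtain ⟨x, hx⟩ := exists_isTruncation N β
  refine ⟨(subst (lieSeries b α (N + 1) : OF K)).toLinearMap, x, ?_, hx, hx.star (by omega), ?_⟩
  · rw [← hr (N + 1) (by omega)]
    exact isTriangular_subst (lieSeries_mem_filtration b α (N + 1))
  · rw [AlgHom.toLinearMap_apply, unshuffle_subst (lieSeries b α (N + 1)).2, sub_self]
    exact Submodule.zero_mem _

theorem starLin_bijective (h : α (lieBullet K) ≠ 0) : Function.Bijective (starLin b α) := by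
  obtain ⟨r, hr, hM⟩ := exists_coeffAt_leaf_lieSeries b α
  refine bijective_of_isTriangular _ (mul_ne_zero hr h) fun N β => ?_
  obtain ⟨f, x, hf, hx, hfx, _⟩ := exists_isTriangular_star b α hM N β
  exact ⟨f, x, hf, hx, hfx⟩

variable {b α} in
theorem isExponential_of_star (h : α (lieBullet K) ≠ 0) {β : Module.Dual K (OF K)}
    (hβ : IsExponential (LieButcher.star b (character α) β)) : IsExponential β := by
  obtain ⟨r, hr, hM⟩ := exists_coeffAt_leaf_lieSeries b α
  exact isExponential_of_triangular hβ ((star_nil b α β).symm.trans hβ.1) (mul_ne_zero hr h)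
    fun N => exists_isTriangular_star b α hM N β

variable {α} in
/-- If `α(•) = 0`, the substituted series starts in degree two and does not reach `•`. -/
theorem star_leaf_eq_zero (h : α (lieBullet K) = 0) (β : Module.Dual K (OF K)) :
    LieButcher.star b (character α) β (basisForest K [PTree.leaf]) = 0 := by
  classical
  have hleaf : Forest.vertices [PTree.leaf] < 2 := by
    simp [Forest.vertices, PTree.vertices, PTree.leaf]
  obtain ⟨r, -, hM⟩ := exists_coeffAt_leaf_lieSeries b α
  obtain ⟨x, hx⟩ := exists_isTruncation 2 β
  rw [← hx.star (b := b) (α := α) (M := 1) le_rfl _ hleaf]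
  have htri := isTriangular_subst (lieSeries_mem_filtration b α 1)
  rw [hM 1 le_rfl, h, mul_zero] at htri
  -- only the constant term of `x` can contribute in degree one
  have hy : x - coeffAt [] x • 1 ∈ filtration K 1 := by
    refine mem_filtration_iff.2 fun ω hω => ?_
    rw [Forest.eq_nil_of_vertices_eq_zero (by omega : Forest.vertices ω = 0), ← basisForest_nil]
    simp [coeffAt_basisForest]
  have := mem_filtration_iff.1 (htri.sub_smul_mem hy) _ hleaf
  rw [pow_one, zero_smul, sub_zero, AlgHom.toLinearMap_apply, map_sub, map_smul, map_one,
    coeffAt_sub, coeffAt_smul, ← basisForest_nil] at this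
  simpa [coeffAt_basisForest] using this

end Star

/-! ### The group of exponential linear maps -/

variable (K) in
/-- The group of exponential linear maps under convolution. -/
@[reducible]
def expGroup : Group (ExpMap K) :=
  letI : Mul (ExpMap K) := ⟨fun β γ => ⟨convN β.1 γ.1, β.2.convN γ.2⟩⟩
  letI : One (ExpMap K) := ⟨⟨counit K, isExponential_counit⟩⟩
  letI : Inv (ExpMap K) := ⟨fun β => ⟨(exists_convN_eq_counit β.2).choose,
    (exists_convN_eq_counit β.2).choose_spec.1⟩⟩
  Group.ofRightAxioms (fun β γ δ => Subtype.ext (convN_assoc β.1 γ.1 δ.1))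
    (fun β => Subtype.ext (convN_counit β.1))
    (fun β => Subtype.ext (exists_convN_eq_counit β.2).choose_spec.2)

/-- The linear map `ω ↦ 1 / ℓ!` for a forest of `ℓ` trees, whose series is the exponential, for
concatenation, of the sum of all trees. -/
def expLength (K : Type*) [Field K] : Module.Dual K (OF K) :=
  linExt fun ω => (ω.length.factorial : K)⁻¹

theorem isExponential_expLength [CharZero K] : IsExponential (expLength K) := by
  refine ⟨by simp [expLength], fun x y => ?_⟩
  suffices e : shuffle.compr₂ (expLength K) =
      (LinearMap.mul K K).compl₁₂ (expLength K) (expLength K) from congr($e x y)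
  refine linearMap_ext fun u => linearMap_ext fun v => ?_
  simp only [LinearMap.compr₂_apply, LinearMap.compl₁₂_apply, LinearMap.mul_apply']
  have h : ∀ w ∈ shuffles u v, expLength K (basisForest K w) =
      ((u.length + v.length).factorial : K)⁻¹ := fun w hw => by
    rw [expLength, linExt_basisForest, length_of_mem_shuffles hw]
  rw [shuffle_basisForest, map_list_sum, List.map_map,
    List.map_congr_left (f := expLength K ∘ basisForest K)
      (g := fun _ => ((u.length + v.length).factorial : K)⁻¹) h,
    List.map_const', List.sum_replicate, length_shuffles, Nat.choose_symm_add, nsmul_eq_mul, expLength,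
    linExt_basisForest, linExt_basisForest]
  have hf (n : ℕ) : (n.factorial : K) ≠ 0 := Nat.cast_ne_zero.2 n.factorial_ne_zero
  have hc := congr(($(Nat.add_choose_mul_factorial_mul_factorial u.length v.length) : K))
  push_cast at hc
  field_simp [hf]
  linear_combination hc

end

end LieButcher

theorem mainTheorem8 {K : Type*} [Field K] [CharZero K]
    {κ : ℕ → Type*} [∀ d, Fintype (κ d)]
    (b : ∀ d, Module.Basis (κ d) K (LieButcher.LiePTDeg K d))
    (α : Module.Dual K (LieButcher.LiePT K)) :
    ∃ _ : Group (LieButcher.ExpMap K),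
      (∀ β γ : LieButcher.ExpMap K,
        ((β * γ : LieButcher.ExpMap K) : Module.Dual K (LieButcher.OF K)) =
          LieButcher.convN β.1 γ.1) ∧
      ∃ Φ : LieButcher.ExpMap K →* LieButcher.ExpMap K,
        (∀ β : LieButcher.ExpMap K,
          ((Φ β : LieButcher.ExpMap K) : Module.Dual K (LieButcher.OF K)) =
            LieButcher.star b (LieButcher.character α) β.1) ∧
        (Function.Bijective Φ ↔ α (LieButcher.lieBullet K) ≠ 0) := by
  let _ := LieButcher.expGroup K
  refine ⟨LieButcher.expGroup K, fun _ _ => rfl,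
    MonoidHom.mk' (fun β => ⟨LieButcher.star b (LieButcher.character α) β.1, β.2.star b⟩)
      (fun β γ => Subtype.ext (LieButcher.star_convN b α β.1 γ.1)), fun _ => rfl, ?_, fun h => ?_⟩
  · intro hbij h
    obtain ⟨β, hβ⟩ := hbij.2 ⟨LieButcher.expLength K, LieButcher.isExponential_expLength⟩
    have h1 := congr(($hβ).1 (LieButcher.basisForest K [LieButcher.PTree.leaf]))
    have h2 := LieButcher.star_leaf_eq_zero b h β.1
    have h3 : LieButcher.expLength K (LieButcher.basisForest K [LieButcher.PTree.leaf]) = 1 := by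
      simp [LieButcher.expLength]
    exact one_ne_zero (h3.symm.trans (h1.symm.trans h2))
  · have hbij := LieButcher.starLin_bijective b α h
    refine ⟨fun β γ hβγ => Subtype.ext (hbij.1 congr(($hβγ).1)), fun γ => ?_⟩
    obtain ⟨β, hβ⟩ := hbij.2 γ.1
    have hβ' : LieButcher.IsExponential (LieButcher.star b (LieButcher.character α) β) := by
      have : LieButcher.star b (LieButcher.character α) β = γ.1 := hβ
      rw [this]
      exact γ.2
    exact ⟨⟨β, LieButcher.isExponential_of_star h hβ'⟩, Subtype.ext hβ⟩
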